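/- Let $d\ge 1$, let $V,W\in L^\infty(\mathbb{R}^d)$ be real-valued and let $\Lambda\subset\mathbb{R}^d$ be measurable (not necessarily bounded). Put $W_\Lambda(x,y)=\chi_{\Lambda\times\Lambda}(x,y)\,W(x-y)$ and, for $\sigma>0$, $\varphi_x^\sigma(y)=(2\pi\sigma^2)^{-d/2}e^{-|y-x|^2/(2\sigma^2)}$. Let $\mathfrak F^-=\bigoplus_{n\ge 0}\mathfrak F_n^-$ be the antisymmetric Fock space over $L^2(\mathbb{R}^d)$, where $\mathfrak F_n^-$ is the space of antisymmetric functions in $L^2((\mathbb{R}^d)^n)$, and let $a(f),a^*(f)$ be the fermionic annihilation and creation operators. For $\sigma>0$ let $$W_{\Lambda;n}^\sigma=\frac12\int_{\mathbb{R}^d}\int_{\mathbb{R}^d}W_\Lambda(x,y)\,a^*(\varphi_x^\sigma)a^*(\varphi_y^\sigma)a(\varphi_y^\sigma)a(\varphi_x^\sigma)\,dx\,dy\Big|_{\mathfrak F_n^-}$$ (a weak integral), and let $W_{\Lambda;n}^0$ be multiplication by $\sum_{1\le k<l\le n}W_\Lambda(x_k,x_l)$, followed by the orthogonal projection onto $\mathfrak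 F_n^-$ (the projection is superfluous if $W$ is even). For $\sigma\ge 0$ let $H_\Lambda^\sigma=\bigoplus_{n\ge0}\big(\sum_{k=1}^n(-\Delta_k+V(x_k))+W_{\Lambda;n}^\sigma\big)$ on $\mathfrak F^-$, with domain the set of all $(\psi_n)\in\mathfrak F^-$ such that $\psi_n\in H^2((\mathbb{R}^d)^n)\cap\mathfrak F_n^-$ for every $n$ and $\sum_n\big\|\big(\sum_{k=1}^n(-\Delta_k+V(x_k))+W_{\Lambda;n}^\sigma\big)\psi_n\big\|^2<\infty$. Then, for every $\sigma\ge0$, $H_\Lambda^\sigma$ is self-adjoint and generates a unique strongly continuous unitary group $U_\Lambda^\sigma(t)=e^{-itH_\Lambda^\sigma}$, and for every $\psi\in\mathfrak F^-$ $$\lim_{\sigma\downarrow0}U_\Lambda^\sigma(t)\psi=U_\Lambda^0(t)\psi,$$ uniformly for $t$ in compact subsets of $\mathbb{R}$. -/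

import Mathlib

open MeasureTheory Filter Topology

noncomputable section

namespace SmearedFermi

/-! ### Configuration space and the antisymmetric subspaces -/

/-- The one-particle configuration space `ℝᵈ`. -/
abbrev Rd (d : ℕ) : Type := EuclideanSpace ℝ (Fin d)

/-- The `n`-particle configuration space `(ℝᵈ)ⁿ` with its Euclidean norm; `x k` is the position of
the `k`-th particle, and `volume` is Lebesgue measure on `ℝⁿᵈ` (the Dirac mass for `n = 0`). -/
abbrev Conf (d n : ℕ) : Type := PiLp 2 (fun _ : Fin n => Rd d)

/-- `L²((ℝᵈ)ⁿ; ℂ)`, i.e. the `n`-fold Hilbert space tensor power of `L²(ℝᵈ)`. -/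
abbrev L2n (d n : ℕ) : Type := Lp ℂ 2 (volume : Measure (Conf d n))

/-- `L²(ℝᵈ; ℂ)`. -/
abbrev L2 (d : ℕ) : Type := Lp ℂ 2 (volume : Measure (Rd d))

/-- The coordinate permutation `x ↦ x ∘ π⁻¹` of the configuration space. -/
def permConf (d : ℕ) {n : ℕ} (π : Equiv.Perm (Fin n)) : Conf d n ≃ₗᵢ[ℝ] Conf d n :=
  LinearIsometryEquiv.piLpCongrLeft 2 ℝ (Rd d) π

lemma permConf_apply (d : ℕ) {n : ℕ} (π : Equiv.Perm (Fin n)) (x : Conf d n) (k : Fin n) :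
    permConf d π x k = x (π.symm k) := rfl

/-- The action of a permutation on wave functions, `ψ ↦ ψ ∘ permConf π`. -/
def permL2 (d : ℕ) {n : ℕ} (π : Equiv.Perm (Fin n)) : L2n d n →L[ℂ] L2n d n :=
  (Lp.compMeasurePreservingₗᵢ ℂ (permConf d π)
    (permConf d π).measurePreserving).toContinuousLinearMap

/-- The `n`-fermion space: all `ψ ∈ L²((ℝᵈ)ⁿ)` with `ψ(x_{π 1}, …, x_{π n}) = sgn(π) ψ(x)` almost
everywhere, for all permutations `π`. -/
def antisym (d n : ℕ) : Submodule ℂ (L2n d n) :=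
  ⨅ π : Equiv.Perm (Fin n),
    (permL2 d π - ((Equiv.Perm.sign π : ℤ) : ℂ) • ContinuousLinearMap.id ℂ (L2n d n)).ker

lemma mem_antisym {d n : ℕ} (ψ : L2n d n) :
    ψ ∈ antisym d n ↔
      ∀ π : Equiv.Perm (Fin n), permL2 d π ψ = ((Equiv.Perm.sign π : ℤ) : ℂ) • ψ := by
  simp [antisym, Submodule.mem_iInf, LinearMap.mem_ker, sub_eq_zero]

instance (d n : ℕ) : CompleteSpace (antisym d n) := by
  have : IsClosed (antisym d n : Set (L2n d n)) := by
    rw [antisym, Submodule.coe_iInf]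
    exact isClosed_iInter fun π => ContinuousLinearMap.isClosed_ker _
  exact this.completeSpace_coe

/-- The antisymmetrization projection `L²((ℝᵈ)ⁿ) → L²((ℝᵈ)ⁿ)⁻` (an orthogonal projection). -/
def antisymProj (d n : ℕ) : L2n d n →L[ℂ] antisym d n :=
  (antisym d n).orthogonalProjectionOnto

/-- The antisymmetric Fock space over `L²(ℝᵈ)`: the Hilbert space direct sum of the `n`-fermion
spaces, `n = 0, 1, 2, …`. -/
abbrev Fock (d : ℕ) : Type := lp (fun n : ℕ => antisym d n) 2

/-! ### Creation and annihilation operators -/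

/-- The isometry `(ℝᵈ)ⁿ⁺¹ ≃ ℝᵈ × (ℝᵈ)ⁿ` that splits off the first particle. -/
def splitFirst (d n : ℕ) : Conf d (n + 1) ≃ₗᵢ[ℝ] WithLp 2 (Rd d × Conf d n) where
  toFun x := WithLp.toLp 2 (x 0, WithLp.toLp 2 fun k => x k.succ)
  invFun p := WithLp.toLp 2 (Fin.cons p.fst fun k => p.snd k)
  map_add' _ _ := rfl
  map_smul' _ _ := rfl
  left_inv x := by
    ext k : 1
    refine Fin.cases ?_ (fun k => ?_) k <;> rfl
  right_inv p := rfl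
  norm_map' x := by
    refine (sq_eq_sq₀ (norm_nonneg _) (norm_nonneg _)).1 ?_
    rw [WithLp.prod_norm_sq_eq_of_L2, PiLp.norm_sq_eq_of_L2 _ x, Fin.sum_univ_succ]
    change ‖x 0‖ ^ 2 + ‖(WithLp.toLp 2 fun k => x k.succ : Conf d n)‖ ^ 2 = _
    rw [PiLp.norm_sq_eq_of_L2 _ (WithLp.toLp 2 fun k => x k.succ : Conf d n)]

lemma measurePreserving_split (d n : ℕ) :
    MeasurePreserving (fun x : Conf d (n + 1) =>
      (x 0, (WithLp.toLp 2 fun k => x k.succ : Conf d n)))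
      volume ((volume : Measure (Rd d)).prod (volume : Measure (Conf d n))) :=
  (WithLp.volume_preserving_ofLp (Rd d) (Conf d n)).comp (splitFirst d n).measurePreserving

lemma eLpNorm_tensor {X Y : Type*} [MeasurableSpace X] [MeasurableSpace Y] {μ : Measure X}
    {ν : Measure Y} [SFinite ν] {f : X → ℂ} {g : Y → ℂ}
    (hf : AEStronglyMeasurable f μ) (hg : AEStronglyMeasurable g ν) :
    eLpNorm (fun p : X × Y => f p.1 * g p.2) 2 (μ.prod ν) = eLpNorm f 2 μ * eLpNorm g 2 ν := by
  simp only [eLpNorm_eq_lintegral_rpow_enorm_toReal (p := 2) two_ne_zero ENNReal.ofNat_ne_top]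
  rw [← ENNReal.mul_rpow_of_nonneg _ _ (by positivity), ← lintegral_prod_mul
    (hf.enorm.pow_const _) (hg.enorm.pow_const _)]
  congr 2
  funext p
  rw [enorm_mul, ENNReal.mul_rpow_of_nonneg _ _ (by positivity)]

lemma memLp_tensor {d n : ℕ} (f : L2 d) (ψ : L2n d n) :
    MemLp (fun x : Conf d (n + 1) => f (x 0) * ψ (WithLp.toLp 2 fun k => x k.succ)) 2 volume := by
  have h : MemLp (fun p : Rd d × Conf d n => f p.1 * ψ p.2) 2
      ((volume : Measure (Rd d)).prod (volume : Measure (Conf d n))) := by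
    refine ⟨(Lp.aestronglyMeasurable f).comp_fst.mul (Lp.aestronglyMeasurable ψ).comp_snd, ?_⟩
    rw [eLpNorm_tensor (Lp.aestronglyMeasurable f) (Lp.aestronglyMeasurable ψ)]
    exact ENNReal.mul_lt_top (Lp.eLpNorm_lt_top f) (Lp.eLpNorm_lt_top ψ)
  exact h.comp_measurePreserving (measurePreserving_split d n)

lemma norm_tensor {d n : ℕ} (f : L2 d) (ψ : L2n d n) :
    ‖(memLp_tensor f ψ).toLp‖ = ‖f‖ * ‖ψ‖ := by
  have h : AEStronglyMeasurable (fun p : Rd d × Conf d n => f p.1 * ψ p.2)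
      ((volume : Measure (Rd d)).prod (volume : Measure (Conf d n))) :=
    (Lp.aestronglyMeasurable f).comp_fst.mul (Lp.aestronglyMeasurable ψ).comp_snd
  rw [Lp.norm_toLp, Lp.norm_def, Lp.norm_def, ← ENNReal.toReal_mul,
    ← eLpNorm_tensor (Lp.aestronglyMeasurable f) (Lp.aestronglyMeasurable ψ),
    ← eLpNorm_comp_measurePreserving h (measurePreserving_split d n)]
  rfl

lemma ae_tail {d n : ℕ} {p : Conf d n → Prop} (h : ∀ᵐ y, p y) :
    ∀ᵐ x : Conf d (n + 1), p (WithLp.toLp 2 fun k => x k.succ) :=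
  ((Measure.quasiMeasurePreserving_snd (μ := (volume : Measure (Rd d)))).comp
    (measurePreserving_split d n).quasiMeasurePreserving).ae h

/-- The creation operator on the full (unsymmetrized) Fock space, from `n` to `n + 1` particles:
`(b*(f)ψ)(x₁, …, xₙ₊₁) = √(n+1) f(x₁) ψ(x₂, …, xₙ₊₁)`. -/
def fullCreate {d : ℕ} (f : L2 d) (n : ℕ) : L2n d n →L[ℂ] L2n d (n + 1) :=
  ((Real.sqrt (n + 1) : ℝ) : ℂ) • LinearMap.mkContinuous
    { toFun := fun ψ => (memLp_tensor f ψ).toLp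
      map_add' := fun ψ φ => by
        rw [← MemLp.toLp_add]
        refine MemLp.toLp_congr _ _ ?_
        filter_upwards [ae_tail (Lp.coeFn_add ψ φ)] with x hx
        simp only [hx, Pi.add_apply, mul_add]
      map_smul' := fun c ψ => by
        rw [← MemLp.toLp_const_smul]
        refine MemLp.toLp_congr _ _ ?_
        filter_upwards [ae_tail (Lp.coeFn_smul c ψ)] with x hx
        simp only [hx, Pi.smul_apply, smul_eq_mul, RingHom.id_apply]
        ring }
    ‖f‖ (fun ψ => (norm_tensor f ψ).le)

/-- The annihilation operator on the full Fock space, from `n + 1` to `n` particles, the adjoint of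
`fullCreate`: `(b(f)ψ)(x₁, …, xₙ) = √(n+1) ∫ conj (f x) ψ(x, x₁, …, xₙ) dx`. -/
def fullAnnihilate {d : ℕ} (f : L2 d) (n : ℕ) : L2n d (n + 1) →L[ℂ] L2n d n :=
  ContinuousLinearMap.adjoint (fullCreate f n)

/-- The fermionic creation operator `a*(f)` from the `n`- to the `(n+1)`-fermion space. -/
def create {d : ℕ} (f : L2 d) (n : ℕ) : antisym d n →L[ℂ] antisym d (n + 1) :=
  antisymProj d (n + 1) ∘L fullCreate f n ∘L (antisym d n).subtypeL

/-- The fermionic annihilation operator `a(f)` from the `(n+1)`- to the `n`-fermion space. -/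
def annihilate {d : ℕ} (f : L2 d) (n : ℕ) : antisym d (n + 1) →L[ℂ] antisym d n :=
  antisymProj d n ∘L fullAnnihilate f n ∘L (antisym d (n + 1)).subtypeL

/-- `a*(f)` is the adjoint of `a(f)`. -/
lemma create_eq_adjoint {d : ℕ} (f : L2 d) (n : ℕ) :
    create f n = ContinuousLinearMap.adjoint (annihilate f n) := by
  rw [ContinuousLinearMap.eq_adjoint_iff]
  intro φ ψ
  calc inner ℂ (create f n φ) ψ
      = inner ℂ (fullCreate f n φ) (ψ : L2n d (n + 1)) :=
        Submodule.inner_orthogonalProjectionOnto_eq_of_mem_right ψ _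
    _ = inner ℂ (φ : L2n d n) (fullAnnihilate f n ψ) :=
        (ContinuousLinearMap.adjoint_inner_right _ _ _).symm
    _ = inner ℂ φ (annihilate f n ψ) :=
        (Submodule.inner_orthogonalProjectionOnto_eq_of_mem_left φ _).symm

/-! ### The interaction -/

/-- The `L¹`-normalized Gaussian centered at `x` with variance `σ²`. -/
def gaussian {d : ℕ} (σ : ℝ) (x y : Rd d) : ℝ :=
  1 / (2 * Real.pi * σ ^ 2) ^ ((d : ℝ) / 2) * Real.exp (-‖y - x‖ ^ 2 / (2 * σ ^ 2))

lemma memLp_gaussian {d : ℕ} {σ : ℝ} (hσ : 0 < σ) (x : Rd d) :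
    MemLp (fun y => (gaussian σ x y : ℂ)) 2 volume := by
  have hc : Continuous fun y : Rd d => (gaussian σ x y : ℂ) := by
    unfold gaussian; fun_prop
  rw [memLp_two_iff_integrable_sq_norm hc.aestronglyMeasurable]
  have h := (((GaussianFourier.integrable_cexp_neg_mul_sq_norm_add (V := Rd d)
    (b := ((1 / σ ^ 2 : ℝ) : ℂ)) (by rw [Complex.ofReal_re]; positivity) 0 0).norm.comp_sub_right
    x).const_mul ((1 / (2 * Real.pi * σ ^ 2) ^ ((d : ℝ) / 2)) ^ 2))
  refine h.congr (Eventually.of_forall fun y => ?_)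
  simp only [gaussian, Complex.norm_real, Real.norm_eq_abs, sq_abs, mul_pow, Complex.norm_exp]
  rw [← Real.exp_nat_mul]
  congr 2
  norm_cast
  simp
  field_simp

/-- The Gaussian `φ_x^σ` as an element of `L²(ℝᵈ)`. -/
def gaussianL2 {d : ℕ} {σ : ℝ} (hσ : 0 < σ) (x : Rd d) : L2 d :=
  (memLp_gaussian hσ x).toLp

/-- The two-body potential restricted to `Λ`: `W_Λ(x, y) = χ_{Λ×Λ}(x, y) W(x - y)`. -/
def pairPotential {d : ℕ} (Λ : Set (Rd d)) (W : Rd d → ℝ) (p : Rd d × Rd d) : ℝ :=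
  (Λ ×ˢ Λ).indicator (fun q => W (q.1 - q.2)) p

section WeakIntegral

variable {X E : Type*} [MeasurableSpace X] [NormedAddCommGroup E] [InnerProductSpace ℂ E]

/-- `S = ∫ T(x) dμ(x)` in the weak sense: all matrix elements `⟨χ, T(x)ψ⟩` are integrable, and
`⟨χ, Sψ⟩` is their integral. There is at most one such `S`. -/
def IsWeakIntegral (μ : Measure X) (T : X → E →L[ℂ] E) (S : E →L[ℂ] E) : Prop :=
  ∀ χ ψ : E, Integrable (fun x => inner ℂ χ (T x ψ)) μ ∧
    inner ℂ χ (S ψ) = ∫ x, inner ℂ χ (T x ψ) ∂μ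

lemma IsWeakIntegral.unique {μ : Measure X} {T : X → E →L[ℂ] E} {S S' : E →L[ℂ] E}
    (h : IsWeakIntegral μ T S) (h' : IsWeakIntegral μ T S') : S = S' := by
  ext ψ
  exact ext_inner_left ℂ fun χ => (h χ ψ).2.trans (h' χ ψ).2.symm

open Classical in
/-- The weak integral of an operator-valued function (`0` if it does not exist). -/
def weakIntegral (μ : Measure X) (T : X → E →L[ℂ] E) : E →L[ℂ] E :=
  if h : ∃ S, IsWeakIntegral μ T S then h.choose else 0

end WeakIntegral

/-- The smeared interaction
`½ ∫∫ W_Λ(x,y) a*(φ_x^σ) a*(φ_y^σ) a(φ_y^σ) a(φ_x^σ) dx dy` on the `n`-fermion space. Products of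
two annihilation operators vanish on the `0`- and the `1`-particle space. -/
def smearedInteraction {d : ℕ} (Λ : Set (Rd d)) (W : Rd d → ℝ) {σ : ℝ} (hσ : 0 < σ) :
    (n : ℕ) → antisym d n →L[ℂ] antisym d n
  | 0 => 0
  | 1 => 0
  | n + 2 => (1 / 2 : ℂ) • weakIntegral (volume : Measure (Rd d × Rd d)) fun p =>
      (pairPotential Λ W p : ℂ) •
        (create (gaussianL2 hσ p.1) (n + 1) ∘L create (gaussianL2 hσ p.2) n ∘L
          annihilate (gaussianL2 hσ p.2) n ∘L annihilate (gaussianL2 hσ p.1) (n + 1))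

open Classical in
/-- Multiplication by an essentially bounded function `g` on `L²((ℝᵈ)ⁿ)`
(`0` if `g` is not in `L^∞`). -/
def mulOp {d n : ℕ} (g : Conf d n → ℝ) : L2n d n →L[ℂ] L2n d n :=
  if hg : MemLp (fun x => (g x : ℂ)) ⊤ (volume : Measure (Conf d n)) then
    (ContinuousLinearMap.mul ℂ ℂ).holderL volume ⊤ 2 2 hg.toLp
  else 0

/-- Multiplication by `g`, compressed to the `n`-fermion space. If `g` is invariant under
permutations of the particles, then this is plain multiplication by `g`. -/
def mulAntisym {d n : ℕ} (g : Conf d n → ℝ) : antisym d n →L[ℂ] antisym d n :=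
  antisymProj d n ∘L mulOp g ∘L (antisym d n).subtypeL

/-- The unregularized interaction: multiplication by `∑_{k<l} W_Λ(x_k, x_l)`. -/
def pointInteraction {d : ℕ} (Λ : Set (Rd d)) (W : Rd d → ℝ) (n : ℕ) :
    antisym d n →L[ℂ] antisym d n :=
  mulAntisym fun x => ∑ k : Fin n, ∑ l ∈ Finset.Ioi k, pairPotential Λ W (x k, x l)

/-- `W_{Λ;n}^σ`: the smeared interaction for `σ > 0`, the unregularized one for `σ = 0`
(negative `σ` is never used). -/
def interaction {d : ℕ} (Λ : Set (Rd d)) (W : Rd d → ℝ) (σ : ℝ) (n : ℕ) :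
    antisym d n →L[ℂ] antisym d n :=
  if hσ : 0 < σ then smearedInteraction Λ W hσ n else pointInteraction Λ W n

/-! ### The Hamiltonian -/

section Laplacian

open TemperedDistribution
open scoped SchwartzMap Laplacian

/-- The Sobolev space `H²((ℝᵈ)ⁿ)` as a subspace of `L²`. -/
def sobolevH2 (d n : ℕ) : Submodule ℂ (L2n d n) where
  carrier := {ψ | MemSobolev 2 2 (Lp.toTemperedDistributionCLM ℂ volume 2 ψ)}
  add_mem' h h' := by simpa only [Set.mem_ofPred_eq, map_add] using h.add h'
  zero_mem' := by simp only [Set.mem_ofPred_eq, map_zero, memSobolev_fun_zero]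
  smul_mem' c _ h := by simpa only [Set.mem_ofPred_eq, map_smul] using h.smul c

lemma exists_laplacian {d n : ℕ} (ψ : sobolevH2 d n) :
    ∃ η : L2n d n, Lp.toTemperedDistributionCLM ℂ volume 2 η =
      Δ (Lp.toTemperedDistributionCLM ℂ volume 2 (ψ : L2n d n)) := by
  have h := MemSobolev.laplacian ψ.2
  rw [sub_self, memSobolev_zero_iff] at h
  obtain ⟨η, hη⟩ := h
  exact ⟨η, hη.symm⟩

lemma toTemperedDistribution_injective (d n : ℕ) :
    Function.Injective (Lp.toTemperedDistributionCLM ℂ (volume : Measure (Conf d n)) 2) :=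
  LinearMap.ker_eq_bot.1 Lp.ker_toTemperedDistributionCLM_eq_bot

/-- The Laplacian on `L²((ℝᵈ)ⁿ)` with domain `H²((ℝᵈ)ⁿ)`: `Δψ` is the element of `L²` that
represents the distributional Laplacian of `ψ` on `ℝⁿᵈ`, which is `∑ₖ Δₖ ψ`. -/
def laplacianL2 (d n : ℕ) : L2n d n →ₗ.[ℂ] L2n d n where
  domain := sobolevH2 d n
  toFun :=
    { toFun := fun ψ => (exists_laplacian ψ).choose
      map_add' := fun ψ φ => by
        refine toTemperedDistribution_injective d n ?_
        rw [map_add, (exists_laplacian _).choose_spec, (exists_laplacian _).choose_spec,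
          (exists_laplacian _).choose_spec, Submodule.coe_add, map_add]
        simp only [← laplacianCLM_apply, map_add]
      map_smul' := fun c ψ => by
        refine toTemperedDistribution_injective d n ?_
        rw [map_smul, (exists_laplacian _).choose_spec, (exists_laplacian _).choose_spec,
          Submodule.coe_smul, map_smul]
        simp only [← laplacianCLM_apply, map_smul, RingHom.id_apply] }

end Laplacian

/-- The kinetic energy `-∑ₖ Δₖ` on the `n`-fermion space, with domain the antisymmetric elements of
`H²((ℝᵈ)ⁿ)`. Since `Δ` commutes with permutations, the projection acts trivially here. -/
def kinetic (d n : ℕ) : antisym d n →ₗ.[ℂ] antisym d n where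
  domain := (sobolevH2 d n).comap (antisym d n).subtype
  toFun :=
    { toFun := fun ψ => antisymProj d n (-(laplacianL2 d n ⟨((ψ : antisym d n) : L2n d n), ψ.2⟩))
      map_add' := fun ψ φ => by
        rw [← map_add, ← neg_add, ← LinearPMap.map_add]; rfl
      map_smul' := fun c ψ => by
        rw [RingHom.id_apply, ← map_smul]
        congr 1
        exact (congrArg Neg.neg (LinearPMap.map_smul (laplacianL2 d n) c
          ⟨((ψ : antisym d n) : L2n d n), ψ.2⟩)).trans (smul_neg _ _).symm }

/-- `H_{1;n} + W_{Λ;n}^σ = ∑ₖ (-Δₖ + V(xₖ)) + W_{Λ;n}^σ` on the `n`-fermion space, with the domain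
of `kinetic`. -/
def hamiltonianN {d : ℕ} (Λ : Set (Rd d)) (V W : Rd d → ℝ) (σ : ℝ) (n : ℕ) :
    antisym d n →ₗ.[ℂ] antisym d n :=
  ((mulAntisym (fun x : Conf d n => ∑ k, V (x k)) + interaction Λ W σ n :
    antisym d n →L[ℂ] antisym d n) : antisym d n →ₗ[ℂ] antisym d n) +ᵥ kinetic d n

/-- The direct sum of a sequence of unbounded operators, with its maximal domain: all `(ψₙ)` with
`ψₙ` in the domain of `Tₙ` and `∑ₙ ‖Tₙ ψₙ‖² < ∞`. -/
def directSum {G : ℕ → Type*} [∀ n, NormedAddCommGroup (G n)] [∀ n, InnerProductSpace ℂ (G n)]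
    (T : ∀ n, G n →ₗ.[ℂ] G n) : lp G 2 →ₗ.[ℂ] lp G 2 where
  domain :=
    { carrier := {ψ | ∃ h : ∀ n, ψ n ∈ (T n).domain, Memℓp (fun n => T n ⟨ψ n, h n⟩) 2}
      add_mem' := by
        rintro ψ φ ⟨h, hm⟩ ⟨h', hm'⟩
        refine ⟨fun n => (T n).domain.add_mem (h n) (h' n), ?_⟩
        convert hm.add hm' using 1
        funext n
        exact (T n).map_add ⟨ψ n, h n⟩ ⟨φ n, h' n⟩
      zero_mem' := by
        refine ⟨fun n => (T n).domain.zero_mem, ?_⟩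
        convert zero_memℓp (E := G) (p := 2) using 1
        funext n
        exact (T n).map_zero
      smul_mem' := by
        rintro c ψ ⟨h, hm⟩
        refine ⟨fun n => (T n).domain.smul_mem c (h n), ?_⟩
        convert hm.const_smul c using 1
        funext n
        exact (T n).map_smul c ⟨ψ n, h n⟩ }
  toFun :=
    { toFun := fun ψ => ⟨fun n => T n ⟨(ψ : lp G 2) n, ψ.2.choose n⟩, ψ.2.choose_spec⟩
      map_add' := fun ψ φ => by
        ext n
        exact (T n).map_add ⟨(ψ : lp G 2) n, ψ.2.choose n⟩ ⟨(φ : lp G 2) n, φ.2.choose n⟩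
      map_smul' := fun c ψ => by
        ext n
        exact (T n).map_smul c ⟨(ψ : lp G 2) n, ψ.2.choose n⟩ }

/-- The Hamiltonian `H_Λ^σ = ⨁ₙ (H_{1;n} + W_{Λ;n}^σ)` on the antisymmetric Fock space. -/
def hamiltonian {d : ℕ} (Λ : Set (Rd d)) (V W : Rd d → ℝ) (σ : ℝ) : Fock d →ₗ.[ℂ] Fock d :=
  directSum fun n => hamiltonianN Λ V W σ n

/-- `U(t) = e^{-itH}`: `U` is a strongly continuous one-parameter group of unitary operators whose
infinitesimal generator is `-iH`, including the domain: `ψ` lies in the domain of `H` with `Hψ = φ`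
if and only if `t ↦ U(t)ψ` is differentiable at `0` with derivative `-iφ`. -/
structure IsUnitaryGroupOf {E : Type*} [NormedAddCommGroup E] [InnerProductSpace ℂ E]
    [CompleteSpace E] (H : E →ₗ.[ℂ] E) (U : ℝ → E →L[ℂ] E) : Prop where
  unitary : ∀ t, U t ∈ unitary (E →L[ℂ] E)
  map_zero : U 0 = 1
  map_add : ∀ s t, U (s + t) = U s * U t
  continuous : ∀ ψ, Continuous fun t => U t ψ
  generator : ∀ ψ φ, (ψ, φ) ∈ H.graph ↔ HasDerivAt (fun t => U t ψ) (-Complex.I • φ) 0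

end SmearedFermi
end

namespace SmearedFermi

/-! On each sector the Hamiltonian is the kinetic energy plus a bounded symmetric operator, hence
self-adjoint as soon as the kinetic energy is (`isSelfAdjoint_kinetic`). Self-adjointness passes to
direct sums with maximal domain, and Stone's theorem (`exists_isUnitaryGroupOf`) supplies the
groups. Everything about unbounded operators is phrased through graphs: an operator is self-adjoint
iff it is densely defined and its graph is its own adjoint relation.

The analytic core is a formula for the smeared interaction. Annihilating two particles with
Gaussians centered at `x` and `y` evaluates at `(x, y)` the Gaussian convolution `S` of the wave
function in its first two variables. Integrating against the pair potential therefore turns the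
centers into particle coordinates and gives `N(N-1)/2 · P S* M S` on `N` particles, where `M` is
multiplication by the potential of the first two particles and `P` is antisymmetrization
(`smearedInteraction_eq`). By antisymmetry all pairs contribute equally, so the unregularized
interaction is the same expression with `S` replaced by the identity (`pointInteraction_eq`). Now
`S` is a contraction converging strongly to the identity, and so is `S*`; hence the interactions
converge strongly on each sector and are bounded there uniformly in `σ` (`tendsto_interaction`).

The bounds grow with the particle number, so the perturbation is not controlled on the whole Fock
space. It need not be: for an initial state in a single sector and in the domain at `σ = 0`,
Duhamel's estimate (`IsUnitaryGroupOf.norm_sub_le`) bounds the difference of the evolutions by a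
time integral that vanishes by dominated convergence. Unitarity makes the set of good initial states
closed, and finite sums of such states are dense. -/

theorem mem_graph_add_bounded {E : Type*} [NormedAddCommGroup E] [InnerProductSpace ℂ E]
    {A : E →ₗ.[ℂ] E} {B : E →L[ℂ] E} {x u : E} :
    (x, u) ∈ ((B : E →ₗ[ℂ] E) +ᵥ A).graph ↔ (x, u - B x) ∈ A.graph := by
  simp only [LinearPMap.mem_graph_iff]
  constructor
  · rintro ⟨x', rfl, rfl⟩
    exact ⟨⟨x', x'.2⟩, rfl, by simp [LinearPMap.vadd_apply]⟩
  · rintro ⟨x', rfl, h⟩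
    exact ⟨⟨x', x'.2⟩, rfl, by simp [LinearPMap.vadd_apply, h]⟩

/-! ### Self-adjoint operators, their graphs and resolvents. -/

section SelfAdjoint

variable {E : Type*} [NormedAddCommGroup E] [InnerProductSpace ℂ E] [CompleteSpace E]

/-- A densely defined operator is self-adjoint if and only if its graph is its own adjoint
relation. -/
theorem isSelfAdjoint_iff_graph {A : E →ₗ.[ℂ] E} :
    IsSelfAdjoint A ↔ Dense (A.domain : Set E) ∧
      ∀ y z, (y, z) ∈ A.graph ↔ ∀ x u, (x, u) ∈ A.graph → inner ℂ z x = inner ℂ y u := by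
  have key : Dense (A.domain : Set E) → ∀ y z, (y, z) ∈ A.adjoint.graph ↔
      ∀ x u, (x, u) ∈ A.graph → inner ℂ z x = inner ℂ y u := by
    intro hd y z
    rw [LinearPMap.mem_graph_iff]
    constructor
    · rintro ⟨y', rfl, rfl⟩ x u hx
      obtain ⟨x', rfl, rfl⟩ := (LinearPMap.mem_graph_iff _).1 hx
      exact LinearPMap.adjoint_isFormalAdjoint hd y' x'
    · intro h
      have h' : ∀ x : A.domain, inner ℂ z (x : E) = inner ℂ y (A x) := fun x =>
        h _ _ (A.mem_graph x)
      exact ⟨⟨y, LinearPMap.mem_adjoint_domain_of_exists y ⟨z, h'⟩⟩, rfl,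
        LinearPMap.adjoint_apply_eq hd _ h'⟩
  constructor
  · intro h
    refine ⟨h.dense_domain, fun y z => ?_⟩
    rw [← key h.dense_domain, LinearPMap.isSelfAdjoint_def.1 h]
  · rintro ⟨hd, h⟩
    rw [LinearPMap.isSelfAdjoint_def]
    refine LinearPMap.eq_of_eq_graph ?_
    ext ⟨y, z⟩
    rw [key hd, h]

/-- Bounded symmetric perturbations preserve self-adjointness. -/
theorem isSelfAdjoint_add_bounded {A : E →ₗ.[ℂ] E} (hA : IsSelfAdjoint A) {B : E →L[ℂ] E}
    (hB : ∀ x y, inner ℂ (B x) y = inner ℂ x (B y)) :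
    IsSelfAdjoint ((B : E →ₗ[ℂ] E) +ᵥ A) := by
  rw [isSelfAdjoint_iff_graph] at hA ⊢
  refine ⟨hA.1, fun y z => ?_⟩
  rw [mem_graph_add_bounded, hA.2]
  constructor
  · intro h x u hx
    have := h x _ (mem_graph_add_bounded.1 hx)
    rw [inner_sub_left, inner_sub_right, hB] at this
    exact sub_left_injective this
  · intro h x u hx
    have := h x (u + B x) (mem_graph_add_bounded.2 (by simpa using hx))
    rw [inner_add_right] at this
    rw [inner_sub_left, this, hB, add_sub_cancel_right]

theorem _root_.IsSelfAdjoint.inner_graph {A : E →ₗ.[ℂ] E} (hA : IsSelfAdjoint A) {x u y v : E}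
    (hx : (x, u) ∈ A.graph) (hy : (y, v) ∈ A.graph) : inner ℂ u y = inner ℂ x v :=
  ((isSelfAdjoint_iff_graph.1 hA).2 x u).1 hx y v hy

/-- The cross term drops out because `⟨u, x⟩` is real, by symmetry of `A`. -/
theorem _root_.IsSelfAdjoint.norm_sub_sq {A : E →ₗ.[ℂ] E} (hA : IsSelfAdjoint A) {x u : E}
    (hx : (x, u) ∈ A.graph) (l : ℝ) :
    ‖u - (l * Complex.I) • x‖ ^ 2 = ‖u‖ ^ 2 + l ^ 2 * ‖x‖ ^ 2 := by
  have h1 : inner ℂ u x = inner ℂ x u := hA.inner_graph hx hx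
  have h2 : (inner ℂ u x).im = 0 := by
    have := congrArg Complex.im (inner_conj_symm u x)
    rw [← h1, Complex.conj_im] at this
    linarith
  have h3 := _root_.norm_sub_sq (𝕜 := ℂ) u ((l * Complex.I) • x)
  rw [h3, inner_smul_right, norm_smul, mul_pow]
  simp [h2]

theorem _root_.IsSelfAdjoint.norm_le_of_graph {A : E →ₗ.[ℂ] E} (hA : IsSelfAdjoint A) {x u : E}
    (hx : (x, u) ∈ A.graph) (l : ℝ) : |l| * ‖x‖ ≤ ‖u - (l * Complex.I) • x‖ := by
  refine le_of_sq_le_sq ?_ (norm_nonneg _)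
  rw [hA.norm_sub_sq hx, mul_pow, sq_abs]
  nlinarith [sq_nonneg ‖u‖]

/-- The range of `A - il` is closed, because the lower bound `|l| ‖x‖ ≤ ‖(A - il)x‖` makes preimages
of a Cauchy sequence Cauchy and the graph is closed. A vector orthogonal to the range is an
eigenvector of `A` for `-il`, and the same bound at `-l` forces it to vanish. -/
theorem _root_.IsSelfAdjoint.exists_sub_eq {A : E →ₗ.[ℂ] E} (hA : IsSelfAdjoint A) {l : ℝ} (hl : l ≠ 0)
    (f : E) : ∃ x u, (x, u) ∈ A.graph ∧ u - (l * Complex.I) • x = f := by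
  let L : E × E →L[ℂ] E := ContinuousLinearMap.snd ℂ E E -
    ((l : ℂ) * Complex.I) • ContinuousLinearMap.fst ℂ E E
  let R : Submodule ℂ E := A.graph.map (L : E × E →ₗ[ℂ] E)
  have hR : ∀ {g : E}, g ∈ R ↔ ∃ x u, (x, u) ∈ A.graph ∧ u - (l * Complex.I) • x = g := by
    intro g
    simp only [R, Submodule.mem_map, Prod.exists]
    rfl
  have hcl : IsClosed (R : Set E) := by
    refine IsSeqClosed.isClosed fun g g0 hg hlim => ?_
    choose x u hxu hxg using fun k => hR.1 (hg k)
    have hc : CauchySeq x := by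
      have hg' := hlim.cauchySeq
      rw [Metric.cauchySeq_iff'] at hg' ⊢
      intro ε hε
      obtain ⟨N, hN⟩ := hg' (|l| * ε) (by positivity)
      refine ⟨N, fun n hn => ?_⟩
      have h1 := hA.norm_le_of_graph (A.graph.sub_mem (hxu n) (hxu N)) l
      have h2 : u n - u N - (l * Complex.I) • (x n - x N) = g n - g N := by
        rw [← hxg, ← hxg, smul_sub]; abel
      have h3 := hN n hn
      rw [dist_eq_norm] at h3 ⊢
      rw [h2] at h1
      exact lt_of_mul_lt_mul_left (h1.trans_lt h3) (abs_nonneg l)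
    obtain ⟨x0, hx0⟩ := cauchySeq_tendsto_of_complete hc
    have hu : Tendsto u atTop (𝓝 (g0 + (l * Complex.I) • x0)) := by
      have := hlim.add (hx0.const_smul ((l : ℂ) * Complex.I))
      refine this.congr fun k => ?_
      rw [← hxg]; simp
    refine hR.2 ⟨x0, _, hA.isClosed.isSeqClosed hxu (hx0.prodMk_nhds hu), by simp⟩
  have : CompleteSpace R := hcl.completeSpace_coe
  have htop : R = ⊤ := by
    rw [← Submodule.orthogonal_eq_bot_iff, Submodule.eq_bot_iff]
    intro z hz
    rw [Submodule.mem_orthogonal'] at hz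
    have hzg : (z, ((-l : ℝ) * Complex.I : ℂ) • z) ∈ A.graph := by
      refine ((isSelfAdjoint_iff_graph.1 hA).2 _ _).2 fun x u hx => ?_
      have := hz _ (hR.2 ⟨x, u, hx, rfl⟩)
      rw [inner_sub_right, inner_smul_right, sub_eq_zero] at this
      rw [this, inner_smul_left]
      simp
    have := hA.norm_le_of_graph hzg (-l)
    rw [sub_self, norm_zero] at this
    have h0 : ‖z‖ = 0 := by
      have h1 : 0 < |(-l)| := abs_pos.2 (neg_ne_zero.2 hl)
      nlinarith [norm_nonneg z]
    simpa using h0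
  exact hR.1 (htop ▸ Submodule.mem_top)

/-- The resolvent of a self-adjoint operator at the point `l * I`. -/
theorem _root_.IsSelfAdjoint.exists_resolvent {A : E →ₗ.[ℂ] E} (hA : IsSelfAdjoint A) {l : ℝ}
    (hl : l ≠ 0) : ∃ R : E →L[ℂ] E, (∀ f, |l| * ‖R f‖ ≤ ‖f‖) ∧
      (∀ f, (R f, f + (l * Complex.I) • R f) ∈ A.graph) ∧
      ∀ x u, (x, u) ∈ A.graph → R (u - (l * Complex.I) • x) = x := by
  choose r v hr hv using hA.exists_sub_eq hl
  have hinj : ∀ x u, (x, u) ∈ A.graph → r (u - (l * Complex.I) • x) = x := by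
    intro x u hx
    set f := u - (l * Complex.I) • x with hf
    have h1 := hA.norm_le_of_graph (A.graph.sub_mem (hr f) hx) l
    have h2 : v f - u - (l * Complex.I) • (r f - x) = 0 := by
      have : v f - u - (l * Complex.I) • (r f - x) =
        (v f - (l * Complex.I) • r f) - (u - (l * Complex.I) • x) := by rw [smul_sub]; abel
      rw [this, hv, hf, sub_self]
    rw [h2, norm_zero] at h1
    have h0 : ‖r f - x‖ = 0 := by
      have h1 : 0 < |l| := abs_pos.2 hl
      nlinarith [norm_nonneg (r f - x)]
    exact sub_eq_zero.1 (norm_eq_zero.1 h0)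
  have hb : ∀ f, |l| * ‖r f‖ ≤ ‖f‖ := fun f => by
    have := hA.norm_le_of_graph (hr f) l
    rwa [hv] at this
  have hadd : ∀ f g, r (f + g) = r f + r g := fun f g => by
    rw [← hinj _ _ (A.graph.add_mem (hr f) (hr g))]
    congr 1
    conv_lhs => rw [← hv f, ← hv g]
    simp only [smul_add]
    abel
  have hsmul : ∀ (c : ℂ) f, r (c • f) = c • r f := fun c f => by
    rw [← hinj _ _ (A.graph.smul_mem c (hr f))]
    congr 1
    conv_lhs => rw [← hv f]
    simp only [smul_sub]
    rw [smul_comm]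
  refine ⟨LinearMap.mkContinuous ⟨⟨r, hadd⟩, hsmul⟩ |l|⁻¹ fun f => ?_, hb, fun f => ?_, hinj⟩
  · rw [inv_mul_eq_div, le_div_iff₀' (abs_pos.2 hl)]
    exact hb f
  · have : f + (l * Complex.I) • r f = v f := by
      conv_lhs => rw [← hv f]
      rw [hv f]
      nth_rw 1 [← hv f]
      simp
    change (r f, f + (l * Complex.I) • r f) ∈ A.graph
    rw [this]
    exact hr f

end SelfAdjoint

/-! ### Direct sums of self-adjoint operators. -/

section DirectSum

variable {G : ℕ → Type*} [∀ n, NormedAddCommGroup (G n)] [∀ n, InnerProductSpace ℂ (G n)]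

theorem mem_graph_directSum {T : ∀ n, G n →ₗ.[ℂ] G n} {x u : lp G 2} :
    (x, u) ∈ (directSum T).graph ↔ ∀ n, (x n, u n) ∈ (T n).graph := by
  simp only [LinearPMap.mem_graph_iff]
  constructor
  · rintro ⟨x', rfl, rfl⟩ n
    exact ⟨⟨(x' : lp G 2) n, x'.2.choose n⟩, rfl, rfl⟩
  · intro h
    choose y hy hu using h
    have h1 : ∀ n, x n ∈ (T n).domain := fun n => hy n ▸ (y n).2
    have h2 : ∀ n, T n ⟨x n, h1 n⟩ = u n := fun n => by
      rw [← hu n]; congr 1; exact Subtype.ext (hy n).symm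
    have h3 : x ∈ (directSum T).domain := by
      refine ⟨h1, ?_⟩
      simp only [h2]
      exact lp.memℓp u
    refine ⟨⟨x, h3⟩, rfl, ?_⟩
    ext n
    exact h2 n

theorem dense_directSum_domain [∀ n, CompleteSpace (G n)] {T : ∀ n, G n →ₗ.[ℂ] G n}
    (hT : ∀ n, Dense ((T n).domain : Set (G n))) :
    Dense ((directSum T).domain : Set (lp G 2)) := by
  rw [Submodule.dense_iff_topologicalClosure_eq_top, Submodule.topologicalClosure_eq_top_iff,
    Submodule.eq_bot_iff]
  intro z hz
  rw [Submodule.mem_orthogonal] at hz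
  ext n
  refine (hT n).eq_zero_of_inner_right ℂ fun v hv => ?_
  have hmem : lp.single 2 n v ∈ (directSum T).domain := by
    refine LinearPMap.mem_domain_of_mem_graph (y := lp.single 2 n (T n ⟨v, hv⟩))
      (mem_graph_directSum.2 fun k => ?_)
    by_cases hk : k = n
    · subst hk
      simpa using (T k).mem_graph ⟨v, hv⟩
    · simp [hk]
  simpa [lp.inner_single_left] using hz _ hmem

/-- Symmetry is summed over the sectors. Conversely, testing the adjoint relation against vectors in
a single sector places each component in the graph of that sector's operator; square summability is
automatic, since both vectors already lie in the direct sum. -/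
theorem isSelfAdjoint_directSum [∀ n, CompleteSpace (G n)] {T : ∀ n, G n →ₗ.[ℂ] G n}
    (hT : ∀ n, IsSelfAdjoint (T n)) : IsSelfAdjoint (directSum T) := by
  rw [isSelfAdjoint_iff_graph]
  refine ⟨dense_directSum_domain fun n => (hT n).dense_domain, fun y z => ⟨fun h x u hx => ?_,
    fun h => mem_graph_directSum.2 fun n => ?_⟩⟩
  · rw [mem_graph_directSum] at h hx
    rw [lp.inner_eq_tsum, lp.inner_eq_tsum]
    exact tsum_congr fun n => (hT n).inner_graph (h n) (hx n)
  · refine ((isSelfAdjoint_iff_graph.1 (hT n)).2 _ _).2 fun x u hx => ?_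
    have := h (lp.single 2 n x) (lp.single 2 n u) (mem_graph_directSum.2 fun k => ?_)
    · simpa [lp.inner_single_right] using this
    · by_cases hk : k = n
      · subst hk
        simpa using hx
      · simp [hk]

end DirectSum

/-! ### Unitary groups, Duhamel's estimate and uniqueness. -/

section UnitaryGroup

variable {E : Type*} [NormedAddCommGroup E] [InnerProductSpace ℂ E] [CompleteSpace E]

namespace IsUnitaryGroupOf

variable {H : E →ₗ.[ℂ] E} {U : ℝ → E →L[ℂ] E}

theorem inner_map (hU : IsUnitaryGroupOf H U) (t : ℝ) (x y : E) :
    inner ℂ (U t x) (U t y) = inner ℂ x y := by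
  rw [← ContinuousLinearMap.adjoint_inner_right, ← ContinuousLinearMap.comp_apply]
  have := Unitary.star_mul_self_of_mem (hU.unitary t)
  rw [ContinuousLinearMap.star_eq_adjoint] at this
  rw [← ContinuousLinearMap.mul_def, this, one_apply_eq_self]

theorem norm_map (hU : IsUnitaryGroupOf H U) (t : ℝ) (x : E) : ‖U t x‖ = ‖x‖ := by
  rw [@norm_eq_sqrt_re_inner ℂ, @norm_eq_sqrt_re_inner ℂ, hU.inner_map]

theorem hasDerivAt (hU : IsUnitaryGroupOf H U) {x u : E} (hx : (x, u) ∈ H.graph) (t : ℝ) :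
    HasDerivAt (fun s => U s x) (U t (-Complex.I • u)) t := by
  have h0 := (hU.generator x u).1 hx
  have h1 : HasDerivAt (fun s => U (s - t) x) (-Complex.I • u) t :=
    HasDerivAt.comp_sub_const t t ((sub_self t).symm ▸ h0)
  have h2 := ((U t).restrictScalars ℝ).hasFDerivAt.comp_hasDerivAt t h1
  refine h2.congr_of_eventuallyEq (Eventually.of_forall fun s => ?_)
  change U s x = U t (U (s - t) x)
  rw [← mul_apply_eq_comp, ← hU.map_add, add_sub_cancel]

theorem map_graph (hU : IsUnitaryGroupOf H U) {x u : E} (hx : (x, u) ∈ H.graph) (t : ℝ) :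
    (U t x, U t u) ∈ H.graph := by
  rw [hU.generator]
  have h0 := (hU.generator x u).1 hx
  have h2 := ((U t).restrictScalars ℝ).hasFDerivAt.comp_hasDerivAt 0 h0
  have h3 : HasDerivAt (fun s => U s (U t x)) (U t (-Complex.I • u)) 0 := by
    refine h2.congr_of_eventuallyEq (Eventually.of_forall fun s => ?_)
    change U s (U t x) = U t (U s x)
    rw [← mul_apply_eq_comp, ← mul_apply_eq_comp, ← hU.map_add,
      ← hU.map_add, add_comm]
  simpa using h3

/-- Duhamel's estimate for an inhomogeneous Schrödinger equation `i v' = H v + i w`. -/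
theorem norm_sub_le (hU : IsUnitaryGroupOf H U) (hH : IsSelfAdjoint H) {v w φ : ℝ → E}
    (hg : ∀ t, (v t, φ t) ∈ H.graph) (hw : Continuous w)
    (hv : ∀ t, HasDerivAt v (w t - Complex.I • φ t) t) (t : ℝ) :
    ‖v t - U t (v 0)‖ ≤ |∫ s in (0 : ℝ)..t, ‖w s‖| := by
  -- In `d/ds ⟨U(s)χ, v(s)⟩` the two terms containing `H` cancel by symmetry, leaving only `⟨U(s)χ,
  -- w(s)⟩`. This needs `χ` in the domain, a restriction that density removes afterwards.
  have key : ∀ χ ∈ H.domain, ‖inner ℂ (U t χ) (v t - U t (v 0))‖ ≤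
      ‖χ‖ * |∫ s in (0 : ℝ)..t, ‖w s‖| := by
    intro χ hχ
    have hχg := H.mem_graph ⟨χ, hχ⟩
    have hder : ∀ s, HasDerivAt (fun s => inner ℂ (U s χ) (v s)) (inner ℂ (U s χ) (w s)) s := by
      intro s
      have h1 := (hU.hasDerivAt hχg s).inner ℂ (hv s)
      have h2 := hH.inner_graph (hU.map_graph hχg s) (hg s)
      refine h1.congr_deriv ?_
      rw [map_smul, inner_sub_right, inner_smul_left, inner_smul_right, h2]
      simp
    have hint := intervalIntegral.integral_eq_sub_of_hasDerivAt (a := 0) (b := t)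
      (fun s _ => hder s) (((hU.continuous χ).inner hw).intervalIntegrable _ _)
    rw [hU.map_zero, one_apply_eq_self] at hint
    rw [inner_sub_right, hU.inner_map, ← hint]
    refine (intervalIntegral.norm_integral_le_abs_of_norm_le (g := fun s => ‖χ‖ * ‖w s‖)
      (Eventually.of_forall fun s => ?_)
      ((continuous_const.mul hw.norm).intervalIntegrable _ _)).trans_eq ?_
    · exact (norm_inner_le_norm _ _).trans_eq (by rw [hU.norm_map])
    · rw [intervalIntegral.integral_const_mul, abs_mul, abs_norm]
  have hdense := hH.dense_domain
  have key2 : ∀ χ, ‖inner ℂ (U t χ) (v t - U t (v 0))‖ ≤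
      ‖χ‖ * |∫ s in (0 : ℝ)..t, ‖w s‖| := fun χ =>
    hdense.induction (P := fun χ => ‖inner ℂ (U t χ) (v t - U t (v 0))‖ ≤
      ‖χ‖ * |∫ s in (0 : ℝ)..t, ‖w s‖|) key (isClosed_le (by fun_prop) (by fun_prop)) χ
  set e := v t - U t (v 0) with he
  -- The choice `χ = U(-t)e` turns the tested inequality into a bound on `‖e‖²`.
  have h4 : U t (U (-t) e) = e := by
    rw [← mul_apply_eq_comp, ← hU.map_add, add_neg_cancel, hU.map_zero]; rfl
  have h5 := key2 (U (-t) e)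
  rw [h4, hU.norm_map, inner_self_eq_norm_sq_to_K] at h5
  have h6 : ‖e‖ * ‖e‖ ≤ ‖e‖ * |∫ s in (0 : ℝ)..t, ‖w s‖| := by
    simpa [sq] using h5
  rcases (norm_nonneg e).eq_or_lt with h | h
  · rw [← h]; exact abs_nonneg _
  · exact le_of_mul_le_mul_left h6 h

/-- An orbit of `U'` starting in the domain solves the equation of `U` without inhomogeneity, so
Duhamel's estimate gives equality there; density does the rest. -/
theorem unique (hH : IsSelfAdjoint H) {U' : ℝ → E →L[ℂ] E} (hU : IsUnitaryGroupOf H U)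
    (hU' : IsUnitaryGroupOf H U') : U = U' := by
  funext t
  refine ContinuousLinearMap.coeFn_injective
    (Continuous.ext_on hH.dense_domain (U t).continuous (U' t).continuous fun x hx => ?_)
  have hg := H.mem_graph ⟨x, hx⟩
  have := hU.norm_sub_le hH (v := fun t => U' t x) (w := fun _ => 0)
    (fun t => hU'.map_graph hg t) continuous_const
    (fun t => by simpa using hU'.hasDerivAt hg t) t
  rw [hU'.map_zero] at this
  have h0 : U' t x - U t x = 0 := by simpa using this
  exact (sub_eq_zero.1 h0).symm

end IsUnitaryGroupOf

theorem isUnitaryGroupOf_exp {A : E →L[ℂ] E} (hA : IsSelfAdjoint A) :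
    IsUnitaryGroupOf ((A : E →ₗ[ℂ] E).toPMap ⊤)
      (fun t : ℝ => NormedSpace.exp (t • (-Complex.I • A))) := by
  have hd : ∀ x, HasDerivAt (fun t : ℝ => NormedSpace.exp (t • (-Complex.I • A)) x)
      (-Complex.I • A x) 0 := by
    intro x
    have h1 := hasDerivAt_exp_smul_const (𝕂 := ℝ) (-Complex.I • A) (0 : ℝ)
    have h2 := ((ContinuousLinearMap.apply ℂ E x).restrictScalars ℝ).hasFDerivAt.comp_hasDerivAt
      (0 : ℝ) h1
    rw [zero_smul, NormedSpace.exp_zero, one_mul] at h2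
    exact h2
  have hc : Continuous fun t : ℝ => NormedSpace.exp (t • (-Complex.I • A)) :=
    continuous_iff_continuousAt.2 fun t =>
      (hasDerivAt_exp_smul_const (𝕂 := ℝ) (-Complex.I • A) t).continuousAt
  refine ⟨fun t => ?_, by simp, fun s t => ?_, fun ψ => ?_, fun ψ φ => ?_⟩
  · have hs : IsSelfAdjoint ((-t) • A) := by
      rw [isSelfAdjoint_iff, star_smul, hA.star_eq, star_trivial]
    have := (selfAdjoint.expUnitary ⟨_, hs⟩).2
    rw [selfAdjoint.expUnitary_coe] at this
    rwa [show t • (-Complex.I • A) = Complex.I • ((-t) • A) by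
      rw [smul_comm, neg_smul, neg_smul, smul_neg]]
  · let _ : NormedAlgebra ℚ (E →L[ℂ] E) := NormedAlgebra.restrictScalars ℚ ℂ _
    rw [add_smul, NormedSpace.exp_add_of_commute]
    exact (Commute.refl _).smul_left _ |>.smul_right _
  · exact hc.clm_apply continuous_const
  · have hg : (ψ, φ) ∈ ((A : E →ₗ[ℂ] E).toPMap ⊤).graph ↔ A ψ = φ := by
      rw [LinearPMap.mem_graph_iff]
      constructor
      · rintro ⟨x, rfl, rfl⟩; rfl
      · rintro rfl; exact ⟨⟨ψ, trivial⟩, rfl, rfl⟩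
    rw [hg]
    constructor
    · rintro rfl; exact hd ψ
    · intro h
      have := (hd ψ).unique h
      simpa using this

end UnitaryGroup
-- Yosida approximation and Stone's theorem.
section Stone

/-- Strong convergence of a bounded sequence of operators may be checked on a dense subspace. -/
theorem tendsto_of_dense_of_bounded {ι F E : Type*} [NormedAddCommGroup F] [NormedAddCommGroup E]
    {l : Filter ι} {D : Set F} (hD : Dense D)
    {T : ι → F → E} {S : F → E} {C : ℝ} (hT : ∀ i x y, ‖T i x - T i y‖ ≤ C * ‖x - y‖)
    (hS : ∀ x y, ‖S x - S y‖ ≤ C * ‖x - y‖)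
    (h : ∀ x ∈ D, Tendsto (fun i => T i x) l (𝓝 (S x))) (x : F) :
    Tendsto (fun i => T i x) l (𝓝 (S x)) := by
  rw [Metric.tendsto_nhds]
  intro ε hε
  have hδ : 0 < ε / (3 * (|C| + 1)) := by positivity
  obtain ⟨y, hy, hxy⟩ := hD.exists_dist_lt x hδ
  have hC : C * ‖x - y‖ < ε / 3 := by
    rw [dist_eq_norm] at hxy
    calc C * ‖x - y‖ ≤ (|C| + 1) * ‖x - y‖ := by
          gcongr
          linarith [le_abs_self C]
      _ < (|C| + 1) * (ε / (3 * (|C| + 1))) := by gcongr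
      _ = ε / 3 := by field_simp
  filter_upwards [Metric.tendsto_nhds.1 (h y hy) (ε / 3) (by positivity)] with i hi
  have h1 := hT i x y
  have h2 := hS x y
  rw [dist_eq_norm] at hi ⊢
  have h3 : T i x - S x = (T i x - T i y) + (T i y - S y) - (S x - S y) := by abel
  rw [h3]
  linarith [norm_sub_le ((T i x - T i y) + (T i y - S y)) (S x - S y),
    norm_add_le (T i x - T i y) (T i y - S y)]

/-- A resolvent maps the graph into itself componentwise. Applying this to the graph points of the
other resolvent gives the commutation. -/
theorem _root_.IsSelfAdjoint.resolvent_commute {E : Type*} [NormedAddCommGroup E]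
    [InnerProductSpace ℂ E] {A : E →ₗ.[ℂ] E} {l m : ℝ} {R S : E →L[ℂ] E}
    (hR : ∀ f, (R f, f + (l * Complex.I) • R f) ∈ A.graph)
    (hR' : ∀ x u, (x, u) ∈ A.graph → R (u - (l * Complex.I) • x) = x)
    (hS : ∀ f, (S f, f + (m * Complex.I) • S f) ∈ A.graph)
    (hS' : ∀ x u, (x, u) ∈ A.graph → S (u - (m * Complex.I) • x) = x) : Commute R S := by
  have h1 : ∀ x u, (x, u) ∈ A.graph → (R x, R u) ∈ A.graph := by
    intro x u hx
    have h2 := hR' x u hx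
    rw [map_sub, map_smul, sub_eq_iff_eq_add] at h2
    rw [h2]
    exact hR x
  ext f
  have h3 := hS' _ _ (h1 _ _ (hS f))
  rw [map_add, map_smul, add_sub_cancel_right] at h3
  exact h3.symm

variable {E : Type*} [NormedAddCommGroup E] [InnerProductSpace ℂ E] [CompleteSpace E]

/-- The Yosida approximation: a self-adjoint operator is the strong limit, on its domain, of
commuting bounded self-adjoint operators. -/
theorem _root_.IsSelfAdjoint.exists_yosida {A : E →ₗ.[ℂ] E} (hA : IsSelfAdjoint A) :
    ∃ Y : ℕ → E →L[ℂ] E, (∀ k, IsSelfAdjoint (Y k)) ∧ (∀ k m, Commute (Y k) (Y m)) ∧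
      ∀ x u, (x, u) ∈ A.graph → Tendsto (fun k => Y k x) atTop (𝓝 u) := by
  let p : ℕ → ℝ := fun k => k + 1
  have hp : ∀ k, 0 < p k := fun k => by positivity
  choose R hRn hRg hRi using fun k => hA.exists_resolvent (hp k).ne'
  choose S hSn hSg hSi using fun k => hA.exists_resolvent (neg_ne_zero.2 (hp k).ne')
  -- The resolvents at the conjugate points `ip` and `-ip` are adjoint to each other.
  have hadj : ∀ k f g, inner ℂ (R k f) g = inner ℂ f (S k g) := by
    intro k f g
    have h := hA.inner_graph (hRg k f) (hSg k g)
    simp only [inner_add_left, inner_add_right, inner_smul_left, inner_smul_right, map_mul,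
      Complex.conj_ofReal, Complex.conj_I] at h
    push_cast at h
    linear_combination -h
  -- On the domain `-iq Qx = x - QAx`, and `‖Q‖ ≤ 1/p` tends to zero. The operators `-iqQ` are
  -- contractions, so convergence extends to all vectors.
  have hlim : ∀ (Q : ℕ → E →L[ℂ] E) (q : ℕ → ℝ), (∀ k, |q k| = p k) →
      (∀ k f, |q k| * ‖Q k f‖ ≤ ‖f‖) →
      (∀ k x u, (x, u) ∈ A.graph → Q k (u - (q k * Complex.I) • x) = x) →
      ∀ x, Tendsto (fun k => -(q k * Complex.I) • Q k x) atTop (𝓝 x) := by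
    intro Q q hq hQn hQi
    refine tendsto_of_dense_of_bounded (C := 1) (S := id) hA.dense_domain ?_ ?_ ?_
    · intro k x y
      rw [← smul_sub, ← map_sub, norm_smul, one_mul]
      refine le_trans (le_of_eq ?_) (hQn k (x - y))
      simp
    · intro x y; simp
    · intro x hx
      have hxg := A.mem_graph ⟨x, hx⟩
      have h1 : ∀ k, -(q k * Complex.I) • Q k x = x - Q k (A ⟨x, hx⟩) := by
        intro k
        have := hQi k _ _ hxg
        rw [map_sub, map_smul] at this
        rw [eq_sub_iff_add_eq, neg_smul]
        rw [sub_eq_iff_eq_add] at this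
        rw [this]; abel
      simp only [h1, id]
      have h2 : Tendsto (fun k => Q k (A ⟨x, hx⟩)) atTop (𝓝 0) := by
        refine squeeze_zero_norm (a := fun k => ‖A ⟨x, hx⟩‖ / p k) (fun k => ?_) ?_
        · rw [le_div_iff₀' (hp k), ← hq]
          exact hQn k _
        · exact tendsto_const_nhds.div_atTop
            (tendsto_atTop_add_const_right _ _ tendsto_natCast_atTop_atTop)
      simpa using tendsto_const_nhds.sub h2
  have hR := hlim R p (fun k => abs_of_pos (hp k)) hRn hRi
  have hS := hlim S (fun k => -p k) (fun k => by rw [abs_neg, abs_of_pos (hp k)]) hSn hSi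
  -- In terms of the spectral variable `a` this is `p²a / (a² + p²)`, which is bounded, real and
  -- tends to `a` as `p → ∞`.
  refine ⟨fun k => ((p k ^ 2 / 2 : ℝ) : ℂ) • (R k + S k), fun k => ?_, fun k m => ?_, ?_⟩
  · have hs : ContinuousLinearMap.adjoint (R k) = S k := by
      rw [eq_comm, ContinuousLinearMap.eq_adjoint_iff]
      intro f g
      rw [← inner_conj_symm, ← hadj, inner_conj_symm]
    rw [isSelfAdjoint_iff, star_smul, star_add, ContinuousLinearMap.star_eq_adjoint,
      ContinuousLinearMap.star_eq_adjoint, hs, ← hs, ContinuousLinearMap.adjoint_adjoint, add_comm]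
    simp [hs]
  · refine Commute.smul_left (Commute.smul_right (Commute.add_left (Commute.add_right ?_ ?_)
      (Commute.add_right ?_ ?_)) _) _
    · exact IsSelfAdjoint.resolvent_commute (hRg k) (hRi k) (hRg m) (hRi m)
    · exact IsSelfAdjoint.resolvent_commute (hRg k) (hRi k) (hSg m) (hSi m)
    · exact IsSelfAdjoint.resolvent_commute (hSg k) (hSi k) (hRg m) (hRi m)
    · exact IsSelfAdjoint.resolvent_commute (hSg k) (hSi k) (hSg m) (hSi m)
  · intro x u hx
    have h := ((hR u).add (hS u)).const_smul (1 / 2 : ℂ)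
    have h2 : (1 / 2 : ℂ) • (u + u) = u := by
      rw [← two_smul ℂ u, smul_smul]; norm_num
    rw [h2] at h
    refine h.congr fun k => ?_
    have e1 := hRi k x u hx
    have e2 := hSi k x u hx
    rw [map_sub, map_smul, sub_eq_iff_eq_add] at e1 e2
    rw [e1, e2, smul_apply, add_apply]
    simp only [smul_add, smul_smul]
    push_cast
    -- After inserting the resolvent identities the terms in `x` cancel, and `I² = -1` leaves the
    -- factor `p²/2` on both resolvents.
    have h3 : ∀ a b c a' : E, ∀ r s r' s' v : ℂ, a = a' → r = -s → r' = v → s' = v →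
        r • a + r' • b + (s • a' + s' • c) = v • b + v • c := by
      rintro a b c a' r s r' s' v rfl rfl rfl rfl
      module
    refine (h3 _ _ _ _ _ _ _ _ _ rfl ?_ ?_ ?_)
    · ring
    · linear_combination (-(p k : ℂ) ^ 2 / 2) * Complex.I_sq
    · linear_combination (-(p k : ℂ) ^ 2 / 2) * Complex.I_sq

/-- **Stone's theorem**: every self-adjoint operator generates a unitary group. -/
theorem exists_isUnitaryGroupOf {A : E →ₗ.[ℂ] E} (hA : IsSelfAdjoint A) :
    ∃ U : ℝ → E →L[ℂ] E, IsUnitaryGroupOf A U := by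
  obtain ⟨Y, hYs, hYc, hYl⟩ := hA.exists_yosida
  let u : ℕ → ℝ → E →L[ℂ] E := fun k t => NormedSpace.exp (t • (-Complex.I • Y k))
  have hu : ∀ k, IsUnitaryGroupOf ((Y k : E →ₗ[ℂ] E).toPMap ⊤) (u k) := fun k =>
    isUnitaryGroupOf_exp (hYs k)
  have hmem : ∀ k x, (x, Y k x) ∈ ((Y k : E →ₗ[ℂ] E).toPMap ⊤).graph := fun k x =>
    ((Y k : E →ₗ[ℂ] E).toPMap ⊤).mem_graph ⟨x, trivial⟩
  have hsa : ∀ k, IsSelfAdjoint ((Y k : E →ₗ[ℂ] E).toPMap ⊤) := fun k => by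
    rw [LinearPMap.isSelfAdjoint_def,
      ContinuousLinearMap.toPMap_adjoint_eq_adjoint_toPMap_of_dense _ dense_univ,
      ← ContinuousLinearMap.star_eq_adjoint, (hYs k).star_eq]
  have hcomm : ∀ k m t x, Y m (u k t x) = u k t (Y m x) := by
    intro k m t x
    have : Commute (Y m) (u k t) :=
      (((hYc m k).smul_right _).smul_right _).exp_right
    exact congrArg (fun T : E →L[ℂ] E => T x) this
  -- Since `u k` commutes with `Y m`, the orbit `u k s x` solves the equation of `Y m` with
  -- inhomogeneity `-i u k s (Y k x - Y m x)`, whose norm does not depend on `s`.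
  have hdiff : ∀ k m t x, ‖u k t x - u m t x‖ ≤ |t| * ‖Y k x - Y m x‖ := by
    intro k m t x
    have h := (hu m).norm_sub_le (hsa m) (v := fun s => u k s x)
      (w := fun s => -Complex.I • u k s (Y k x - Y m x)) (fun s => hmem m _)
      (((hu k).continuous _).const_smul _) (fun s => ?_) t
    · simp only [norm_smul, (hu k).norm_map, norm_neg, Complex.norm_I, one_mul] at h
      simpa [(hu k).map_zero, abs_mul] using h
    · refine ((hu k).hasDerivAt (hmem k x) s).congr_deriv ?_
      rw [map_smul, hcomm, map_sub, smul_sub]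
      module
  have hlip : ∀ k t x y, ‖u k t x - u k t y‖ ≤ 1 * ‖x - y‖ := by
    intro k t x y
    rw [← map_sub, (hu k).norm_map, one_mul]
  have hcauchy : ∀ t x, CauchySeq fun k => u k t x := by
    intro t x
    rw [Metric.cauchySeq_iff]
    intro ε hε
    obtain ⟨y, hy, hxy⟩ := hA.dense_domain.exists_dist_lt x (ε := ε / 3) (by positivity)
    have h1 := ((hYl _ _ (A.mem_graph ⟨y, hy⟩)).const_smul |t|).cauchySeq
    rw [Metric.cauchySeq_iff] at h1
    obtain ⟨N, hN⟩ := h1 (ε / 3) (by positivity)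
    refine ⟨N, fun k hk m hm => ?_⟩
    have h2 := hN k hk m hm
    rw [dist_eq_norm, ← smul_sub, norm_smul, norm_abs_eq_norm, Real.norm_eq_abs] at h2
    have h3 := hdiff k m t y
    have h4 := hlip k t x y
    have h5 := hlip m t x y
    rw [dist_eq_norm] at hxy ⊢
    have h6 : u k t x - u m t x =
      (u k t x - u k t y) + (u k t y - u m t y) - (u m t x - u m t y) := by abel
    rw [h6]
    refine (norm_sub_le _ _).trans_lt ?_
    have := norm_add_le (u k t x - u k t y) (u k t y - u m t y)
    linarith
  choose f hf using fun t x => cauchySeq_tendsto_of_complete (hcauchy t x)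
  have hnorm : ∀ t x, ‖f t x‖ = ‖x‖ := fun t x =>
    tendsto_nhds_unique ((hf t x).norm) (by simp only [(hu _).norm_map, tendsto_const_nhds])
  let U : ℝ → E →L[ℂ] E := fun t => LinearMap.mkContinuous
    { toFun := f t
      map_add' := fun x y => tendsto_nhds_unique (hf t (x + y))
        (by simpa only [map_add] using (hf t x).add (hf t y))
      map_smul' := fun c x => tendsto_nhds_unique (hf t (c • x))
        (by simpa only [map_smul, RingHom.id_apply] using (hf t x).const_smul c) } 1
    (fun x => by rw [one_mul]; exact (hnorm t x).le)
  have hU : ∀ t x, Tendsto (fun k => u k t x) atTop (𝓝 (U t x)) := hf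
  have hUn : ∀ t x, ‖U t x‖ = ‖x‖ := hnorm
  have hUadd : ∀ s t, U (s + t) = U s * U t := by
    intro s t
    ext x
    refine tendsto_nhds_unique (hU (s + t) x) ?_
    have h1 : Tendsto (fun k => u k s (u k t x) - u k s (U t x)) atTop (𝓝 0) := by
      refine squeeze_zero_norm (fun k => (hlip k s _ _).trans_eq (one_mul _)) ?_
      simpa using ((hU t x).sub_const (U t x)).norm
    have h2 := h1.add (hU s (U t x))
    simp only [sub_add_cancel, zero_add] at h2
    refine h2.congr fun k => ?_
    rw [(hu k).map_add]; rfl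
  have hU0 : U 0 = 1 := by
    ext x
    refine tendsto_nhds_unique (hU 0 x) ?_
    simp [(hu _).map_zero]
  -- For initial states in the domain, letting `m → ∞` in `hdiff` gives an error linear in `|t|`. An
  -- `ε/3` argument covers the remaining states.
  have hunif : ∀ T x, TendstoUniformlyOn (fun k t => u k t x) (fun t => U t x) atTop
      (Metric.ball 0 T) := by
    intro T x
    rw [Metric.tendstoUniformlyOn_iff]
    intro ε hε
    obtain ⟨y, hy, hxy⟩ := hA.dense_domain.exists_dist_lt x (ε := ε / 3) (by positivity)
    have h1 := (hYl _ _ (A.mem_graph ⟨y, hy⟩)).const_smul |T|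
    filter_upwards [Metric.tendsto_nhds.1 h1 (ε / 3) (by positivity)] with k hk t ht
    rw [dist_eq_norm, ← smul_sub, norm_smul, norm_abs_eq_norm, Real.norm_eq_abs] at hk
    have h2 : ‖u k t y - U t y‖ ≤ |t| * ‖Y k y - A ⟨y, hy⟩‖ :=
      le_of_tendsto_of_tendsto (tendsto_const_nhds.sub (hU t y)).norm
        ((tendsto_const_nhds.sub (hYl _ _ (A.mem_graph ⟨y, hy⟩))).norm.const_mul |t|)
        (Eventually.of_forall fun m => hdiff k m t y)
    have h3 : |t| ≤ |T| := by
      rw [mem_ball_zero_iff, Real.norm_eq_abs] at ht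
      exact ht.le.trans (le_abs_self T)
    have h4 := mul_le_mul_of_nonneg_right h3 (norm_nonneg (Y k y - A ⟨y, hy⟩))
    have h5 := hlip k t x y
    have h6 : ‖U t x - U t y‖ = ‖x - y‖ := by rw [← map_sub, hUn]
    rw [dist_eq_norm] at hxy
    rw [dist_comm, dist_eq_norm]
    have h7 : u k t x - U t x =
      (u k t x - u k t y) + (u k t y - U t y) - (U t x - U t y) := by abel
    rw [h7]
    refine (norm_sub_le _ _).trans_lt ?_
    have := norm_add_le (u k t x - u k t y) (u k t y - U t y)
    linarith
  have hcont : ∀ x, Continuous fun t => U t x := by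
    intro x
    rw [continuous_iff_continuousAt]
    intro t
    have ht : Metric.ball (0 : ℝ) (|t| + 1) ∈ 𝓝 t :=
      Metric.isOpen_ball.mem_nhds (by simp)
    exact ((hunif (|t| + 1) x).continuousOn
      (Frequently.of_forall fun k => ((hu k).continuous x).continuousOn)).continuousAt ht
  have hUinner : ∀ t x y, inner ℂ (U t x) (U t y) = inner ℂ x y := fun t x y =>
    tendsto_nhds_unique ((hU t x).inner (hU t y))
      (by simp only [(hu _).inner_map, tendsto_const_nhds])
  -- The derivatives `u k t (-i Y k x)` converge uniformly near `0` as well, which permits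
  -- differentiating the limit.
  have hder : ∀ x y, (x, y) ∈ A.graph → HasDerivAt (fun t => U t x) (-Complex.I • y) 0 := by
    intro x y hxy
    have h := hasDerivAt_of_tendstoUniformlyOn (f := fun k t => u k t x) (l := atTop)
      (f' := fun k t => u k t (-Complex.I • Y k x)) (g := fun t => U t x)
      (g' := fun t => U t (-Complex.I • y)) (s := Metric.ball 0 1) (x := 0) Metric.isOpen_ball
      ?_ (Eventually.of_forall fun k t _ => (hu k).hasDerivAt (hmem k x) t)
      (fun t _ => hU t x) (by simp)
    · simpa only [hU0, one_apply_eq_self] using h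
    · have h1 := hunif 1 (-Complex.I • y)
      rw [Metric.tendstoUniformlyOn_iff] at h1 ⊢
      intro ε hε
      have h2 := Metric.tendsto_nhds.1 ((hYl x y hxy).const_smul (-Complex.I)) (ε / 2)
        (by positivity)
      filter_upwards [h1 (ε / 2) (by positivity), h2] with k hk hk2 t ht
      have h3 := hlip k t (-Complex.I • Y k x) (-Complex.I • y)
      have h4 := hk t ht
      rw [one_mul, ← dist_eq_norm, ← dist_eq_norm] at h3
      have h5 := dist_triangle (U t (-Complex.I • y)) (u k t (-Complex.I • y))
        (u k t (-Complex.I • Y k x))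
      rw [dist_comm (u k t (-Complex.I • y))] at h5
      linarith
  refine ⟨U, fun t => ?_, hU0, hUadd, hcont, fun ψ φ => ⟨hder ψ φ, fun h => ?_⟩⟩
  · have h1 : ∀ t, star (U t) * U t = 1 := by
      intro t
      ext x
      refine ext_inner_left ℂ fun y => ?_
      rw [mul_apply_eq_comp, ContinuousLinearMap.star_eq_adjoint,
        ContinuousLinearMap.adjoint_inner_right, hUinner]
      rfl
    have h2 : U t * U (-t) = 1 := by rw [← hUadd, add_neg_cancel, hU0]
    have h3 : star (U t) = U (-t) := by
      calc star (U t) = star (U t) * (U t * U (-t)) := by rw [h2, mul_one]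
        _ = U (-t) := by rw [← mul_assoc, h1, one_mul]
    rw [Unitary.mem_iff]
    exact ⟨h1 t, by rw [h3, h2]⟩
  -- The generator cannot be larger than `A`: differentiating the constant `⟨U(t)x, U(t)ψ⟩` at `0`
  -- for `x` in the domain puts `(ψ, φ)` in the adjoint relation, which is the graph of `A`.
  · refine ((isSelfAdjoint_iff_graph.1 hA).2 _ _).2 fun x y hxy => ?_
    have h1 := (hder x y hxy).inner ℂ h
    simp only [hUinner] at h1
    have h2 := h1.unique (hasDerivAt_const _ _)
    simp only [hU0, one_apply_eq_self, inner_smul_right, inner_smul_left] at h2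
    have h3 : inner ℂ x φ = inner ℂ y ψ := by
      have : Complex.I * (inner ℂ x φ - inner ℂ y ψ) = 0 := by
        simp at h2
        linear_combination -h2
      simpa [sub_eq_zero] using this
    rw [← inner_conj_symm, h3, inner_conj_symm]

end Stone
-- The Laplacian and the kinetic energy on antisymmetric functions.
section Kinetic

open TemperedDistribution FourierTransform
open scoped SchwartzMap Laplacian LineDeriv ComplexConjugate ContDiff

variable {d n : ℕ}

/-- Complex conjugation of Schwartz functions. -/
noncomputable def conjSchwartz {X : Type*} [NormedAddCommGroup X] [NormedSpace ℝ X] (s : 𝓢(X, ℂ)) : 𝓢(X, ℂ) :=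
  s.postcompCLM (Complex.conjCLE : ℂ →L[ℝ] ℂ)

theorem conjSchwartz_apply {X : Type*} [NormedAddCommGroup X] [NormedSpace ℝ X] (s : 𝓢(X, ℂ))
    (x : X) : conjSchwartz s x = conj (s x) := rfl

theorem conjSchwartz_conjSchwartz {X : Type*} [NormedAddCommGroup X] [NormedSpace ℝ X]
    (s : 𝓢(X, ℂ)) : conjSchwartz (conjSchwartz s) = s := by
  ext x; simp [conjSchwartz_apply]

theorem laplacian_conjSchwartz {X : Type*} [NormedAddCommGroup X] [InnerProductSpace ℝ X]
    [FiniteDimensional ℝ X] (s : 𝓢(X, ℂ)) : Δ (conjSchwartz s) = conjSchwartz (Δ s) := by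
  ext x
  rw [SchwartzMap.laplacian_apply, conjSchwartz_apply, SchwartzMap.laplacian_apply]
  exact congrFun (InnerProductSpace.laplacian_CLE_comp_left (f := s) (l := Complex.conjCLE)) x

theorem inner_schwartz_toLp {X : Type*} [NormedAddCommGroup X] [InnerProductSpace ℝ X]
    [FiniteDimensional ℝ X] [MeasurableSpace X] [BorelSpace X] (s : 𝓢(X, ℂ))
    (f : Lp ℂ 2 (volume : Measure X)) :
    inner ℂ (s.toLp 2) f = Lp.toTemperedDistributionCLM ℂ volume 2 f (conjSchwartz s) := by
  rw [Lp.toTemperedDistributionCLM_apply, Lp.toTemperedDistribution_apply, L2.inner_def]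
  refine integral_congr_ae ?_
  filter_upwards [s.coeFn_toLp 2 volume] with x hx
  rw [hx, conjSchwartz_apply, RCLike.inner_apply, smul_eq_mul, mul_comm]

/-- With the Fourier convention `e^{-2πi x·ξ}`, the symbol `1 + |ξ|²` of the Bessel potential
belongs to `1 - (2π)⁻²Δ`. It maps `y` to `y - (2π)⁻² z`, which is in `L²`. -/
theorem memSobolev_two_of_laplacian {y z : L2n d n}
    (h : Lp.toTemperedDistributionCLM ℂ volume 2 z =
      Δ (Lp.toTemperedDistributionCLM ℂ volume 2 y)) : y ∈ sobolevH2 d n := by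
  change MemSobolev 2 2 (Lp.toTemperedDistributionCLM ℂ volume 2 y)
  have h1 : (fun x : Conf d n => (((1 + ‖x‖ ^ 2) ^ ((2 : ℝ) / 2) : ℝ) : ℂ)) =
      (fun _ => (1 : ℂ)) + fun x => (((‖x‖ ^ 2 : ℝ)) : ℂ) := by
    funext x; simp
  refine ⟨y - ((2 * Real.pi) ^ 2)⁻¹ • z, ?_⟩
  rw [besselPotential, h1, fourierMultiplierCLM_apply, smulLeftCLM_add (by fun_prop) (by fun_prop),
    add_apply, smulLeftCLM_const, one_smul, FourierTransform.fourierInv_add,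
    FourierTransform.fourierInv_fourier_eq, ← fourierMultiplierCLM_apply,
    ← Lp.toTemperedDistributionCLM_apply, map_sub]
  have h2 : Lp.toTemperedDistributionCLM ℂ volume 2 (((2 * Real.pi) ^ 2)⁻¹ • z) =
      ((2 * Real.pi) ^ 2)⁻¹ • Lp.toTemperedDistributionCLM ℂ volume 2 z :=
    ContinuousLinearMap.map_smul_of_tower _ _ _
  rw [h2, h, laplacian_eq_fourierMultiplierCLM, smul_smul, sub_eq_add_neg, ← neg_smul]
  have h3 : -(((2 * Real.pi) ^ 2)⁻¹ * -(2 * Real.pi) ^ 2) = 1 := by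
    have := Real.pi_pos
    field_simp
  rw [h3, one_smul]

theorem mem_graph_laplacianL2 {y z : L2n d n} : (y, z) ∈ (laplacianL2 d n).graph ↔
    Lp.toTemperedDistributionCLM ℂ volume 2 z =
      Δ (Lp.toTemperedDistributionCLM ℂ volume 2 y) := by
  rw [LinearPMap.mem_graph_iff]
  constructor
  · rintro ⟨y', rfl, rfl⟩
    exact (exists_laplacian y').choose_spec
  · intro h
    refine ⟨⟨y, memSobolev_two_of_laplacian h⟩, rfl, toTemperedDistribution_injective d n ?_⟩
    rw [h]
    exact (exists_laplacian ⟨y, memSobolev_two_of_laplacian h⟩).choose_spec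

/-- The distributional Laplacian is the adjoint of the Laplacian on Schwartz functions. Conjugation
converts the bilinear distribution pairing into the sesquilinear inner product. -/
theorem mem_graph_laplacianL2_iff_inner {y z : L2n d n} : (y, z) ∈ (laplacianL2 d n).graph ↔
    ∀ s : 𝓢(Conf d n, ℂ), inner ℂ (s.toLp 2) z = inner ℂ ((Δ s).toLp 2) y := by
  rw [mem_graph_laplacianL2]
  simp only [inner_schwartz_toLp, ← laplacian_conjSchwartz, ← laplacian_apply_apply]
  constructor
  · intro h s
    rw [h]
  · intro h
    ext s
    rw [← conjSchwartz_conjSchwartz s]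
    exact h _

theorem schwartz_mem_graph_laplacianL2 (s : 𝓢(Conf d n, ℂ)) :
    (s.toLp 2 volume, (Δ s).toLp 2 volume) ∈ (laplacianL2 d n).graph := by
  rw [mem_graph_laplacianL2, Lp.toTemperedDistributionCLM_apply, Lp.toTemperedDistributionCLM_apply,
    Lp.toTemperedDistribution_toLp_eq, Lp.toTemperedDistribution_toLp_eq,
    laplacian_toTemperedDistributionCLM_eq]

/-- The Laplacian is multiplication by `-(2 π |ξ|)²` in Fourier space. -/
theorem fourier_laplacianL2 {y z : L2n d n} (h : (y, z) ∈ (laplacianL2 d n).graph) :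
    ∀ᵐ ξ, (𝓕 z : L2n d n) ξ = ((-(2 * Real.pi) ^ 2 * ‖ξ‖ ^ 2 : ℝ) : ℂ) * (𝓕 y : L2n d n) ξ := by
  rw [mem_graph_laplacianL2] at h
  have hl : LocallyIntegrable (𝓕 y : L2n d n) volume :=
    (Lp.memLp _).locallyIntegrable (by norm_num)
  -- The product with `|ξ|²` is a priori only locally integrable, so the two sides are compared
  -- against compactly supported smooth functions.
  refine ae_eq_of_integral_contDiff_smul_eq ((Lp.memLp _).locallyIntegrable (by norm_num)) ?_ ?_
  · rw [← locallyIntegrableOn_univ] at hl ⊢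
    exact hl.continuousOn_mul (by fun_prop) isClosed_univ.isLocallyClosed
  · intro g hg hgc
    have hg₁ : HasCompactSupport (Complex.ofRealCLM ∘ g) := hgc.comp_left rfl
    have hg₂ : ContDiff ℝ ∞ (Complex.ofRealCLM ∘ g) := by fun_prop
    set G := hg₁.toSchwartzMap hg₂ with hG
    have hGx : ∀ x, G x = (g x : ℂ) := fun x => rfl
    have h1 : (𝓕 (Lp.toTemperedDistributionCLM ℂ volume 2 z)) G =
        (𝓕 (Δ (Lp.toTemperedDistributionCLM ℂ volume 2 y))) G := by rw [h]
    have htg : (fun x : Conf d n => ((‖x‖ ^ 2 : ℝ) : ℂ)).HasTemperateGrowth := by fun_prop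
    rw [laplacian_eq_fourierMultiplierCLM, fourierMultiplierCLM_apply,
      ← Complex.coe_smul, FourierTransform.fourier_smul,
      FourierTransform.fourier_fourierInv_eq, Lp.toTemperedDistributionCLM_apply,
      Lp.toTemperedDistributionCLM_apply, Lp.fourier_toTemperedDistribution_eq,
      Lp.fourier_toTemperedDistribution_eq, smul_apply, smulLeftCLM_apply_apply,
      Lp.toTemperedDistribution_apply, Lp.toTemperedDistribution_apply, ← integral_smul] at h1
    calc ∫ x, g x • (𝓕 z : L2n d n) x = ∫ x, G x • (𝓕 z : L2n d n) x := rfl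
      _ = _ := h1
      _ = _ := by
        refine integral_congr_ae (Eventually.of_forall fun x => ?_)
        simp only [SchwartzMap.smulLeftCLM_apply_apply htg, hGx, smul_eq_mul, Complex.real_smul]
        push_cast
        ring

/-- By Plancherel, since the Fourier symbol is real. -/
theorem laplacianL2_symmetric {y z x u : L2n d n} (h : (y, z) ∈ (laplacianL2 d n).graph)
    (h' : (x, u) ∈ (laplacianL2 d n).graph) : inner ℂ z x = inner ℂ y u := by
  rw [← Lp.inner_fourier_eq, ← Lp.inner_fourier_eq y, L2.inner_def, L2.inner_def]
  refine integral_congr_ae ?_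
  filter_upwards [fourier_laplacianL2 h, fourier_laplacianL2 h'] with ξ h1 h2
  rw [h1, h2]
  simp only [RCLike.inner_apply, map_mul, Complex.conj_ofReal]
  ring

/-! ### Permutations -/

theorem permL2_coeFn (π : Equiv.Perm (Fin n)) (ψ : L2n d n) :
    permL2 d π ψ =ᵐ[volume] fun x => ψ (permConf d π x) :=
  Lp.coeFn_compMeasurePreserving ψ (permConf d π).measurePreserving

theorem permL2_permL2 (π ρ : Equiv.Perm (Fin n)) (ψ : L2n d n) :
    permL2 d ρ (permL2 d π ψ) = permL2 d (π * ρ) ψ := by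
  refine Lp.ext ?_
  filter_upwards [permL2_coeFn ρ (permL2 d π ψ), permL2_coeFn (π * ρ) ψ,
    (permConf d ρ).measurePreserving.quasiMeasurePreserving.ae (permL2_coeFn π ψ)] with x h1 h2 h3
  rw [h1, h2, h3]
  rfl

theorem permL2_one (ψ : L2n d n) : permL2 d 1 ψ = ψ := by
  refine Lp.ext ?_
  filter_upwards [permL2_coeFn 1 ψ] with x h1
  rw [h1]
  rfl

theorem inner_permL2_permL2 (π : Equiv.Perm (Fin n)) (ψ φ : L2n d n) :
    inner ℂ (permL2 d π ψ) (permL2 d π φ) = inner ℂ ψ φ :=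
  (Lp.compMeasurePreservingₗᵢ ℂ (permConf d π) (permConf d π).measurePreserving).inner_map_map ψ φ

/-- The antisymmetrizer. -/
noncomputable def antisymmetrize (d n : ℕ) : L2n d n →L[ℂ] L2n d n :=
  ((n.factorial : ℂ)⁻¹) • ∑ π : Equiv.Perm (Fin n), ((Equiv.Perm.sign π : ℤ) : ℂ) • permL2 d π

theorem antisymmetrize_apply (ψ : L2n d n) : antisymmetrize d n ψ =
    ((n.factorial : ℂ)⁻¹) • ∑ π : Equiv.Perm (Fin n),
      ((Equiv.Perm.sign π : ℤ) : ℂ) • permL2 d π ψ := by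
  simp [antisymmetrize, sum_apply]

theorem sign_mul_self (π : Equiv.Perm (Fin n)) :
    ((Equiv.Perm.sign π : ℤ) : ℂ) * ((Equiv.Perm.sign π : ℤ) : ℂ) = 1 := by
  rcases Int.units_eq_one_or (Equiv.Perm.sign π) with h | h <;> simp [h]

theorem antisymmetrize_mem (ψ : L2n d n) : antisymmetrize d n ψ ∈ antisym d n := by
  rw [mem_antisym]
  intro ρ
  rw [antisymmetrize_apply, map_smul, map_sum, smul_comm]
  congr 1
  rw [Finset.smul_sum]
  refine Fintype.sum_equiv (Equiv.mulRight ρ) _ _ fun π => ?_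
  rw [map_smul, permL2_permL2, smul_smul, Equiv.coe_mulRight, Equiv.Perm.sign_mul]
  congr 1
  push_cast
  rw [mul_comm, mul_assoc, sign_mul_self, mul_one]

theorem inner_permL2_of_mem {y : L2n d n} (hy : y ∈ antisym d n) (π : Equiv.Perm (Fin n))
    (ψ : L2n d n) : inner ℂ y (permL2 d π ψ) = ((Equiv.Perm.sign π : ℤ) : ℂ) * inner ℂ y ψ := by
  rw [← inner_permL2_permL2 π y ψ, (mem_antisym y).1 hy, inner_smul_left, ← mul_assoc]
  rw [map_intCast, sign_mul_self, one_mul]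

/-- Every permutation contributes its sign squared. This allows antisymmetric vectors to be tested
against all Schwartz functions while staying in the antisymmetric domain. -/
theorem inner_antisymmetrize {y : L2n d n} (hy : y ∈ antisym d n) (ψ : L2n d n) :
    inner ℂ y (antisymmetrize d n ψ) = inner ℂ y ψ := by
  rw [antisymmetrize_apply, inner_smul_right, inner_sum]
  simp only [inner_smul_right, inner_permL2_of_mem hy, ← mul_assoc, sign_mul_self, one_mul]
  rw [Finset.sum_const, Finset.card_univ, Fintype.card_perm, Fintype.card_fin, nsmul_eq_mul,
    ← mul_assoc, inv_mul_cancel₀ (Nat.cast_ne_zero.2 n.factorial_ne_zero), one_mul]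

/-- The antisymmetrizer on Schwartz functions. -/
noncomputable def antisymSchwartz (s : 𝓢(Conf d n, ℂ)) : 𝓢(Conf d n, ℂ) :=
  ((n.factorial : ℂ)⁻¹) • ∑ π : Equiv.Perm (Fin n), ((Equiv.Perm.sign π : ℤ) : ℂ) •
    SchwartzMap.compCLMOfContinuousLinearEquiv ℂ (permConf d π).toContinuousLinearEquiv s

theorem toLp_comp_permConf (π : Equiv.Perm (Fin n)) (s : 𝓢(Conf d n, ℂ)) :
    (SchwartzMap.compCLMOfContinuousLinearEquiv ℂ
      (permConf d π).toContinuousLinearEquiv s).toLp 2 = permL2 d π (s.toLp 2) := by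
  refine Lp.ext ?_
  filter_upwards [permL2_coeFn π (s.toLp 2), SchwartzMap.coeFn_toLp
    (SchwartzMap.compCLMOfContinuousLinearEquiv ℂ (permConf d π).toContinuousLinearEquiv s) 2 volume,
    (permConf d π).measurePreserving.quasiMeasurePreserving.ae (s.coeFn_toLp 2 volume)]
    with x h1 h2 h3
  rw [h1, h2, h3]
  rfl

theorem toLp_antisymSchwartz (s : 𝓢(Conf d n, ℂ)) :
    (antisymSchwartz s).toLp 2 = antisymmetrize d n (s.toLp 2) := by
  rw [antisymmetrize_apply, antisymSchwartz, ← SchwartzMap.toLpCLM_apply (𝕜 := ℂ), map_smul,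
    map_sum]
  simp only [map_smul, SchwartzMap.toLpCLM_apply, toLp_comp_permConf]

/-- The Laplacian may be computed in any orthonormal basis; transporting the basis by the isometry
matches the two sums term by term. -/
theorem laplacian_comp_isometry {X : Type*} [NormedAddCommGroup X] [InnerProductSpace ℝ X]
    [FiniteDimensional ℝ X] (e : X ≃ₗᵢ[ℝ] X) (s : 𝓢(X, ℂ)) :
    Δ (SchwartzMap.compCLMOfContinuousLinearEquiv ℂ e.toContinuousLinearEquiv s) =
      SchwartzMap.compCLMOfContinuousLinearEquiv ℂ e.toContinuousLinearEquiv (Δ s) := by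
  rw [SchwartzMap.laplacian_eq_sum (stdOrthonormalBasis ℝ X),
    SchwartzMap.laplacian_eq_sum ((stdOrthonormalBasis ℝ X).map e), map_sum]
  simp only [SchwartzMap.lineDerivOp_compCLMOfContinuousLinearEquiv]
  rfl

theorem laplacian_antisymSchwartz (s : 𝓢(Conf d n, ℂ)) :
    Δ (antisymSchwartz s) = antisymSchwartz (Δ s) := by
  rw [antisymSchwartz, antisymSchwartz, ← SchwartzMap.laplacianCLM_eq ℂ, map_smul, map_sum]
  simp only [map_smul, SchwartzMap.laplacianCLM_eq, laplacian_comp_isometry]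

theorem antisymProj_of_mem {ψ : L2n d n} (h : ψ ∈ antisym d n) : antisymProj d n ψ = ⟨ψ, h⟩ :=
  Submodule.orthogonalProjectionOnto_mem_subspace_eq_self (⟨ψ, h⟩ : antisym d n)

theorem inner_antisymProj_left (ψ : L2n d n) (φ : antisym d n) :
    inner ℂ (antisymProj d n ψ) φ = inner ℂ ψ (φ : L2n d n) :=
  Submodule.inner_orthogonalProjectionOnto_eq_of_mem_right φ ψ

theorem inner_antisymProj_right (φ : antisym d n) (ψ : L2n d n) :
    inner ℂ φ (antisymProj d n ψ) = inner ℂ (φ : L2n d n) ψ :=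
  Submodule.inner_orthogonalProjectionOnto_eq_of_mem_left φ ψ

theorem mem_graph_kinetic {y z : antisym d n} : (y, z) ∈ (kinetic d n).graph ↔
    ∃ w, ((y : L2n d n), w) ∈ (laplacianL2 d n).graph ∧ z = antisymProj d n (-w) := by
  simp only [LinearPMap.mem_graph_iff]
  constructor
  · rintro ⟨y', rfl, rfl⟩
    exact ⟨_, ⟨⟨((y' : antisym d n) : L2n d n), y'.2⟩, rfl, rfl⟩, rfl⟩
  · rintro ⟨w, ⟨y', h, rfl⟩, rfl⟩
    refine ⟨⟨y, ?_⟩, rfl, ?_⟩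
    · change (y : L2n d n) ∈ sobolevH2 d n
      rw [← h]; exact y'.2
    · change antisymProj d n (-(laplacianL2 d n ⟨(y : L2n d n), _⟩)) = _
      congr 3
      exact Subtype.ext h.symm

theorem antisymSchwartz_mem (s : 𝓢(Conf d n, ℂ)) : (antisymSchwartz s).toLp 2 volume ∈ antisym d n := by
  rw [toLp_antisymSchwartz]
  exact antisymmetrize_mem _

theorem antisymSchwartz_mem_graph_kinetic (s : 𝓢(Conf d n, ℂ)) :
    ((⟨(antisymSchwartz s).toLp 2 volume, antisymSchwartz_mem s⟩ : antisym d n),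
      (-⟨(antisymSchwartz (Δ s)).toLp 2 volume, antisymSchwartz_mem (Δ s)⟩ : antisym d n)) ∈
      (kinetic d n).graph := by
  rw [mem_graph_kinetic]
  refine ⟨_, schwartz_mem_graph_laplacianL2 (antisymSchwartz s), ?_⟩
  rw [map_neg, laplacian_antisymSchwartz, antisymProj_of_mem (antisymSchwartz_mem (Δ s))]

/-- The kinetic energy is self-adjoint on the `n`-fermion space. -/
theorem isSelfAdjoint_kinetic (d n : ℕ) : IsSelfAdjoint (kinetic d n) := by
  rw [isSelfAdjoint_iff_graph]
  refine ⟨?_, fun y z => ⟨?_, ?_⟩⟩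
  · rw [Submodule.dense_iff_topologicalClosure_eq_top, Submodule.topologicalClosure_eq_top_iff,
      Submodule.eq_bot_iff]
    intro z hz
    rw [Submodule.mem_orthogonal'] at hz
    have h : ∀ f : L2n d n, inner ℂ (z : L2n d n) f = 0 := by
      refine fun f => (SchwartzMap.denseRange_toLpCLM (E := Conf d n) (F := ℂ) (p := 2)
        (μ := volume) (by norm_num)).induction_on (p := fun f => inner ℂ (z : L2n d n) f = 0) f
        (isClosed_eq (by fun_prop) continuous_const) fun s => ?_
      rw [SchwartzMap.toLpCLM_apply, ← inner_antisymmetrize z.2, ← toLp_antisymSchwartz]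
      exact hz _ (LinearPMap.mem_domain_of_mem_graph (antisymSchwartz_mem_graph_kinetic s))
    exact Subtype.ext (inner_self_eq_zero.1 (h z))
  · intro h x u hx
    obtain ⟨w, hw, rfl⟩ := mem_graph_kinetic.1 h
    obtain ⟨v, hv, rfl⟩ := mem_graph_kinetic.1 hx
    rw [inner_antisymProj_left, inner_antisymProj_right, inner_neg_left, inner_neg_right,
      laplacianL2_symmetric hw hv]
  · intro h
    -- The adjoint relation against antisymmetrized Schwartz functions says that the distributional
    -- Laplacian of `y` is `-z`, an element of `L²`; elliptic regularity is contained in the graph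
    -- criterion for the Laplacian.
    refine mem_graph_kinetic.2 ⟨-z, ?_, ?_⟩
    · rw [mem_graph_laplacianL2_iff_inner]
      intro s
      have h1 := h _ _ (antisymSchwartz_mem_graph_kinetic s)
      rw [Submodule.coe_inner, Submodule.coe_inner] at h1
      simp only [Submodule.coe_neg, inner_neg_right, toLp_antisymSchwartz,
        inner_antisymmetrize z.2, inner_antisymmetrize y.2] at h1
      rw [inner_neg_right, ← inner_conj_symm, h1, map_neg, inner_conj_symm, neg_neg]
    · rw [neg_neg, antisymProj_of_mem z.2]

end Kinetic
-- Multiplication operators, symmetry of the interaction, reduction to one pair.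
section Multiplication

variable {d n : ℕ}

/-- The image of Haar measure is a multiple of Haar measure, the factor possibly being infinite.
Absolute continuity is enough to pull back essential bounds along `(x, y) ↦ x - y` and along pairs
of coordinates. -/
theorem quasiMeasurePreserving_of_surjective {X Y : Type*} [NormedAddCommGroup X]
    [NormedSpace ℝ X] [FiniteDimensional ℝ X] [MeasurableSpace X] [BorelSpace X]
    [NormedAddCommGroup Y] [NormedSpace ℝ Y] [MeasurableSpace Y] [BorelSpace Y]
    (μ : Measure X) [μ.IsAddHaarMeasure] (ν : Measure Y) [ν.IsAddHaarMeasure] (L : X →ₗ[ℝ] Y)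
    (hL : Function.Surjective L) : Measure.QuasiMeasurePreserving L μ ν := by
  have : FiniteDimensional ℝ Y := Module.Finite.of_surjective L hL
  obtain ⟨c, -, hc⟩ := L.exists_map_addHaar_eq_smul_addHaar μ ν hL
  refine ⟨(LinearMap.continuous_of_finiteDimensional L).measurable, ?_⟩
  rw [hc]
  exact Measure.smul_absolutelyContinuous

theorem memLp_top_comp {X Y : Type*} [MeasurableSpace X] [MeasurableSpace Y] {μ : Measure X}
    {ν : Measure Y} {f : X → Y} (hf : Measure.QuasiMeasurePreserving f μ ν) {g : Y → ℝ}
    (hg : MemLp g ⊤ ν) : MemLp (fun x => g (f x)) ⊤ μ := by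
  refine memLp_top_of_bound (hg.1.comp_quasiMeasurePreserving hf) (eLpNorm g ⊤ ν).toReal ?_
  have h : ∀ᵐ y ∂ν, ‖g y‖ ≤ (eLpNorm g ⊤ ν).toReal := by
    filter_upwards [ae_le_eLpNormEssSup (f := g) (μ := ν)] with y hy
    rw [← eLpNorm_exponent_top] at hy
    rw [← toReal_enorm]
    exact ENNReal.toReal_mono hg.2.ne hy
  exact hf.ae h

theorem isAddHaarMeasure_volume_prod (X Y : Type*) [NormedAddCommGroup X] [MeasureSpace X]
    [NormedAddCommGroup Y] [MeasureSpace Y] [(volume : Measure X).IsAddHaarMeasure]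
    [(volume : Measure Y).IsAddHaarMeasure] [SFinite (volume : Measure X)]
    [SFinite (volume : Measure Y)] [MeasurableAdd X] [MeasurableAdd Y] :
    (volume : Measure (X × Y)).IsAddHaarMeasure := by
  rw [Measure.volume_eq_prod]
  infer_instance

theorem memLp_pairPotential {Λ : Set (Rd d)} {W : Rd d → ℝ} (hW : MemLp W ⊤ volume)
    (hΛ : NullMeasurableSet Λ volume) :
    MemLp (pairPotential Λ W) ⊤ (volume : Measure (Rd d × Rd d)) := by
  have := isAddHaarMeasure_volume_prod (Rd d) (Rd d)
  have h1 : MemLp (fun p : Rd d × Rd d => W (p.1 - p.2)) ⊤ volume :=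
    memLp_top_comp (quasiMeasurePreserving_of_surjective volume volume
      (LinearMap.fst ℝ (Rd d) (Rd d) - LinearMap.snd ℝ (Rd d) (Rd d))
      fun x => ⟨(x, 0), by simp⟩) hW
  refine h1.mono (h1.1.indicator₀ (hΛ.prod hΛ)) (Eventually.of_forall fun p => ?_)
  exact norm_indicator_le_norm_self _ _

/-- The map that reads off the positions of two different particles. -/
noncomputable def pairMap (d : ℕ) {n : ℕ} (k l : Fin n) : Conf d n →ₗ[ℝ] Rd d × Rd d where
  toFun x := (x k, x l)
  map_add' _ _ := rfl
  map_smul' _ _ := rfl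

theorem quasiMeasurePreserving_pairMap {k l : Fin n} (hkl : k ≠ l) :
    Measure.QuasiMeasurePreserving (fun x : Conf d n => (x k, x l)) volume volume := by
  have := isAddHaarMeasure_volume_prod (Rd d) (Rd d)
  refine quasiMeasurePreserving_of_surjective volume volume (pairMap d k l) fun p => ?_
  refine ⟨WithLp.toLp 2 fun j => if j = k then p.1 else p.2, ?_⟩
  exact Prod.ext (if_pos rfl) (if_neg hkl.symm)

theorem memLp_pairPotential_comp {Λ : Set (Rd d)} {W : Rd d → ℝ} (hW : MemLp W ⊤ volume)
    (hΛ : NullMeasurableSet Λ volume) {k l : Fin n} (hkl : k ≠ l) :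
    MemLp (fun x : Conf d n => pairPotential Λ W (x k, x l)) ⊤ volume :=
  memLp_top_comp (quasiMeasurePreserving_pairMap hkl) (memLp_pairPotential hW hΛ)

theorem mulOp_coeFn {g : Conf d n → ℝ} (hg : MemLp g ⊤ volume) (ψ : L2n d n) :
    mulOp g ψ =ᵐ[volume] fun x => (g x : ℂ) * ψ x := by
  have hg' : MemLp (fun x => (g x : ℂ)) ⊤ (volume : Measure (Conf d n)) := hg.ofReal
  rw [mulOp, dif_pos hg', ContinuousLinearMap.holderL_apply_apply]
  filter_upwards [ContinuousLinearMap.coeFn_holder (r := 2) (ContinuousLinearMap.mul ℂ ℂ) hg'.toLp ψ,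
    hg'.coeFn_toLp] with x h1 h2
  rw [h1, h2, ContinuousLinearMap.mul_apply']

theorem mulOp_symmetric (g : Conf d n → ℝ) (φ ψ : L2n d n) :
    inner ℂ (mulOp g φ) ψ = inner ℂ φ (mulOp g ψ) := by
  by_cases hg : MemLp (fun x => (g x : ℂ)) ⊤ (volume : Measure (Conf d n))
  · have hg' : MemLp g ⊤ volume := by simpa using hg.re
    rw [L2.inner_def, L2.inner_def]
    refine integral_congr_ae ?_
    filter_upwards [mulOp_coeFn hg' φ, mulOp_coeFn hg' ψ] with x h1 h2
    rw [h1, h2]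
    simp only [RCLike.inner_apply, map_mul, Complex.conj_ofReal]
    ring
  · simp [mulOp, dif_neg hg]

theorem mulAntisym_symmetric (g : Conf d n → ℝ) (φ ψ : antisym d n) :
    inner ℂ (mulAntisym g φ) ψ = inner ℂ φ (mulAntisym g ψ) :=
  (inner_antisymProj_left _ _).trans
    ((mulOp_symmetric g _ _).trans (inner_antisymProj_right _ _).symm)

theorem smul_symmetric {E : Type*} [NormedAddCommGroup E] [InnerProductSpace ℂ E] {c : ℂ}
    (hc : (starRingEnd ℂ) c = c) {S : E →L[ℂ] E}
    (hS : ∀ φ ψ, inner ℂ (S φ) ψ = inner ℂ φ (S ψ)) (φ ψ : E) :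
    inner ℂ ((c • S) φ) ψ = inner ℂ φ ((c • S) ψ) := by
  rw [smul_apply, smul_apply, inner_smul_left, inner_smul_right, hc, hS]

/-- Existence of the integral plays no role: the default value `0` is symmetric too. -/
theorem weakIntegral_symmetric {X E : Type*} [MeasurableSpace X] [NormedAddCommGroup E]
    [InnerProductSpace ℂ E] {μ : Measure X} {T : X → E →L[ℂ] E}
    (hT : ∀ x φ ψ, inner ℂ (T x φ) ψ = inner ℂ φ (T x ψ)) (φ ψ : E) :
    inner ℂ (weakIntegral μ T φ) ψ = inner ℂ φ (weakIntegral μ T ψ) := by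
  rw [weakIntegral]
  split_ifs with h
  · rw [(h.choose_spec φ ψ).2, ← inner_conj_symm, (h.choose_spec ψ φ).2, ← integral_conj]
    simp only [inner_conj_symm, hT]
  · simp

theorem weakIntegral_eq {X E : Type*} [MeasurableSpace X] [NormedAddCommGroup E]
    [InnerProductSpace ℂ E] {μ : Measure X} {T : X → E →L[ℂ] E} {S : E →L[ℂ] E}
    (h : IsWeakIntegral μ T S) : weakIntegral μ T = S := by
  have h' : ∃ S, IsWeakIntegral μ T S := ⟨S, h⟩
  rw [weakIntegral, dif_pos h']
  exact h'.choose_spec.unique h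

theorem inner_create_create {f g : L2 d} (φ ψ : antisym d (n + 2)) :
    inner ℂ φ ((create f (n + 1) ∘L create g n ∘L annihilate g n ∘L annihilate f (n + 1)) ψ) =
      inner ℂ (annihilate g n (annihilate f (n + 1) φ))
        (annihilate g n (annihilate f (n + 1) ψ)) := by
  simp only [ContinuousLinearMap.comp_apply, create_eq_adjoint,
    ContinuousLinearMap.adjoint_inner_right]

theorem inner_create_create_left {f g : L2 d} (φ ψ : antisym d (n + 2)) :
    inner ℂ ((create f (n + 1) ∘L create g n ∘L annihilate g n ∘L annihilate f (n + 1)) φ) ψ =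
      inner ℂ (annihilate g n (annihilate f (n + 1) φ))
        (annihilate g n (annihilate f (n + 1) ψ)) := by
  simp only [ContinuousLinearMap.comp_apply, create_eq_adjoint,
    ContinuousLinearMap.adjoint_inner_left]

theorem interaction_symmetric (Λ : Set (Rd d)) (W : Rd d → ℝ) (σ : ℝ) (n : ℕ)
    (φ ψ : antisym d n) :
    inner ℂ (interaction Λ W σ n φ) ψ = inner ℂ φ (interaction Λ W σ n ψ) := by
  rw [interaction]
  split_ifs with hσ
  · match n with
    | 0 => simp [smearedInteraction]
    | 1 => simp [smearedInteraction]
    | n + 2 =>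
      refine smul_symmetric (by norm_num [map_ofNat]) (weakIntegral_symmetric fun p =>
        smul_symmetric (Complex.conj_ofReal _) fun φ ψ => ?_) φ ψ
      rw [inner_create_create_left, inner_create_create]
  · exact mulAntisym_symmetric _ φ ψ

/-- The `n`-particle Hamiltonians are self-adjoint. -/
theorem isSelfAdjoint_hamiltonianN (Λ : Set (Rd d)) (V W : Rd d → ℝ) (σ : ℝ) (n : ℕ) :
    IsSelfAdjoint (hamiltonianN Λ V W σ n) :=
  isSelfAdjoint_add_bounded (isSelfAdjoint_kinetic d n) fun φ ψ => by
    rw [add_apply, add_apply, inner_add_left, inner_add_right,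
      mulAntisym_symmetric, interaction_symmetric]

theorem isSelfAdjoint_hamiltonian (Λ : Set (Rd d)) (V W : Rd d → ℝ) (σ : ℝ) :
    IsSelfAdjoint (hamiltonian Λ V W σ) :=
  isSelfAdjoint_directSum (isSelfAdjoint_hamiltonianN Λ V W σ)

/-! ### The unregularized interaction -/

theorem mulOp_permL2 {g : Conf d n → ℝ} (hg : MemLp g ⊤ volume) (π : Equiv.Perm (Fin n))
    (ψ : L2n d n) :
    permL2 d π (mulOp g ψ) = mulOp (fun x => g (permConf d π x)) (permL2 d π ψ) := by
  have hq := (permConf d π).measurePreserving.quasiMeasurePreserving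
  refine Lp.ext ?_
  filter_upwards [permL2_coeFn π (mulOp g ψ), hq.ae (mulOp_coeFn hg ψ), permL2_coeFn π ψ,
    mulOp_coeFn (memLp_top_comp hq hg) (permL2 d π ψ)] with x h1 h2 h3 h4
  rw [h1, h2, h4, h3]

/-- Permuting the variables in the matrix element yields the sign once from each vector, and the two
signs cancel. -/
theorem inner_mulOp_perm {g : Conf d n → ℝ} (hg : MemLp g ⊤ volume) (π : Equiv.Perm (Fin n))
    (φ ψ : antisym d n) :
    inner ℂ (φ : L2n d n) (mulOp (fun x => g (permConf d π x)) ψ) =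
      inner ℂ (φ : L2n d n) (mulOp g ψ) := by
  have h1 : (ψ : L2n d n) = ((Equiv.Perm.sign π : ℤ) : ℂ) • permL2 d π ψ := by
    rw [(mem_antisym _).1 ψ.2, smul_smul, sign_mul_self, one_smul]
  conv_lhs => rw [h1]
  rw [map_smul, ← mulOp_permL2 hg, inner_smul_right, inner_permL2_of_mem φ.2, ← mul_assoc,
    sign_mul_self, one_mul]

theorem mulOp_sum {ι : Type*} (s : Finset ι) {g : ι → Conf d n → ℝ}
    (hg : ∀ i ∈ s, MemLp (g i) ⊤ volume) (ψ : L2n d n) :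
    mulOp (fun x => ∑ i ∈ s, g i x) ψ = ∑ i ∈ s, mulOp (g i) ψ := by
  have h : ∀ i ∈ s, ∀ᵐ x, mulOp (g i) ψ x = (g i x : ℂ) * ψ x := fun i hi =>
    mulOp_coeFn (hg i hi) ψ
  refine Lp.ext ?_
  filter_upwards [mulOp_coeFn (memLp_finsetSum s hg) ψ, Lp.coeFn_finsetSum s fun i => mulOp (g i) ψ,
    (Finset.eventually_all s).2 h] with x h1 h2 h3
  rw [h1, h2, Finset.sum_apply, Finset.sum_congr rfl h3, ← Finset.sum_mul]
  push_cast
  rfl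

/-- Relabeling the particles turns the pair `(k, l)` into `(0, 1)` without changing matrix elements
between antisymmetric vectors, so it remains to count pairs. The relabeling respects the order
within a pair, so `W` need not be even. -/
theorem pointInteraction_eq {Λ : Set (Rd d)} {W : Rd d → ℝ} (hW : MemLp W ⊤ volume)
    (hΛ : NullMeasurableSet Λ volume) (n : ℕ) :
    pointInteraction Λ W (n + 2) = (((n + 1) * (n + 2) / 2 : ℝ) : ℂ) •
      (mulAntisym fun x : Conf d (n + 2) => pairPotential Λ W (x 0, x 1)) := by
  have hne : ∀ k : Fin (n + 2), ∀ l ∈ Finset.Ioi k, k ≠ l := fun k l hl =>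
    (Finset.mem_Ioi.1 hl).ne
  ext1 ψ
  refine ext_inner_left ℂ fun φ => ?_
  rw [smul_apply, inner_smul_right]
  refine (inner_antisymProj_right φ _).trans ?_
  change _ = _ * inner ℂ φ (antisymProj d _ (mulOp _ (ψ : L2n d (n + 2))))
  rw [inner_antisymProj_right]
  change inner ℂ (φ : L2n d (n + 2)) (mulOp _ (ψ : L2n d (n + 2))) = _
  rw [mulOp_sum _ fun k _ => memLp_finsetSum _ fun l hl =>
    memLp_pairPotential_comp hW hΛ (hne k l hl), inner_sum]
  have h : ∀ k : Fin (n + 2), inner ℂ (φ : L2n d (n + 2))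
      (mulOp (fun x => ∑ l ∈ Finset.Ioi k, pairPotential Λ W (x k, x l)) ψ) =
      ((n + 1 - k : ℝ) : ℂ) * inner ℂ (φ : L2n d (n + 2))
        (mulOp (fun x => pairPotential Λ W (x 0, x 1)) ψ) := by
    intro k
    rw [mulOp_sum _ fun l hl => memLp_pairPotential_comp hW hΛ (hne k l hl), inner_sum]
    have h2 : ∀ l ∈ Finset.Ioi k, inner ℂ (φ : L2n d (n + 2))
        (mulOp (fun x => pairPotential Λ W (x k, x l)) ψ) = inner ℂ (φ : L2n d (n + 2))
        (mulOp (fun x => pairPotential Λ W (x 0, x 1)) ψ) := by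
      intro l hl
      have hkl := hne k l hl
      -- Swapping `0` and `k` takes care of `0 ↦ k`. A preceding swap of `1` with the preimage of
      -- `l`, which is not `0`, achieves `1 ↦ l`.
      obtain ⟨ρ, h0, h1⟩ : ∃ ρ : Equiv.Perm (Fin (n + 2)), ρ 0 = k ∧ ρ 1 = l := by
        have h0l : Equiv.swap 0 k l ≠ 0 := by
          rw [Ne, Equiv.swap_apply_eq_iff, Equiv.swap_apply_left]
          exact hkl.symm
        refine ⟨(Equiv.swap 1 (Equiv.swap 0 k l)).trans (Equiv.swap 0 k), ?_, ?_⟩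
        · rw [Equiv.trans_apply, Equiv.swap_apply_of_ne_of_ne (by simp) h0l.symm,
            Equiv.swap_apply_left]
        · rw [Equiv.trans_apply, Equiv.swap_apply_left, Equiv.swap_apply_self]
      have h01 : (0 : Fin (n + 2)) ≠ 1 := by simp
      rw [← inner_mulOp_perm (memLp_pairPotential_comp hW hΛ h01) ρ.symm]
      simp only [permConf_apply, Equiv.symm_symm, h0, h1]
    rw [Finset.sum_congr rfl h2, Finset.sum_const, Fin.card_Ioi, nsmul_eq_mul]
    congr 1
    have := k.2
    have h3 : n + 2 - 1 - (k : ℕ) + k = n + 1 := by omega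
    have h4 : ((n + 2 - 1 - (k : ℕ) : ℕ) : ℝ) = n + 1 - k := by
      rw [eq_sub_iff_add_eq]; exact_mod_cast h3
    rw [← h4]; simp
  rw [Finset.sum_congr rfl fun k _ => h k, ← Finset.sum_mul]
  congr 1
  rw [← Complex.ofReal_sum]
  congr 1
  rw [Fin.sum_univ_eq_sum_range fun k : ℕ => (n + 1 - k : ℝ)]
  have h5 : ∀ m : ℕ, ∑ k ∈ Finset.range m, (k : ℝ) = m * (m - 1) / 2 := by
    intro m
    induction m with
    | zero => simp
    | succ m ih => rw [Finset.sum_range_succ, ih]; push_cast; ring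
  rw [Finset.sum_sub_distrib, h5]
  simp
  ring

theorem pointInteraction_of_le_one (Λ : Set (Rd d)) (W : Rd d → ℝ) (hn : n ≤ 1) :
    pointInteraction Λ W n = 0 := by
  have h : (fun x : Conf d n => ∑ k : Fin n, ∑ l ∈ Finset.Ioi k, pairPotential Λ W (x k, x l)) =
      fun _ => 0 := by
    funext x
    refine Finset.sum_eq_zero fun k _ => Finset.sum_eq_zero fun l hl => ?_
    have := Finset.mem_Ioi.1 hl
    omega
  ext1 ψ
  rw [pointInteraction, h]
  have h2 : mulOp (fun _ => 0) (ψ : L2n d n) = 0 := by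
    refine Lp.ext ?_
    filter_upwards [mulOp_coeFn (d := d) (n := n) (g := fun _ => 0) MemLp.zero' (ψ : L2n d n),
      Lp.coeFn_zero ℂ 2 (volume : Measure (Conf d n))] with x h1 h2
    rw [h1, h2]; simp
  change antisymProj d n (mulOp (fun _ => 0) (ψ : L2n d n)) = 0
  rw [h2, map_zero]

end Multiplication
-- Gaussian convolution in the first two particles.
section Smearing

variable {d n : ℕ}

/-! ### Splitting off two particles -/

/-- The measurable equivalence `(ℝᵈ)ⁿ⁺² ≃ (ℝᵈ × ℝᵈ) × (ℝᵈ)ⁿ` that splits off two particles. -/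
noncomputable def splitPair (d n : ℕ) : Conf d (n + 2) ≃ᵐ (Rd d × Rd d) × Conf d n where
  toFun x := ((x 0, x 1), WithLp.toLp 2 fun k => x k.succ.succ)
  invFun q := WithLp.toLp 2 (Fin.cons q.1.1 (Fin.cons q.1.2 fun k => q.2 k))
  left_inv x := by
    ext k : 1
    refine Fin.cases ?_ (fun k => ?_) k
    · rfl
    · refine Fin.cases ?_ (fun k => ?_) k <;> rfl
  right_inv q := rfl
  measurable_toFun := by
    change Measurable fun x : Conf d (n + 2) =>
      ((x 0, x 1), (WithLp.toLp 2 fun k => x k.succ.succ : Conf d n))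
    fun_prop
  measurable_invFun := by
    refine (WithLp.measurable_toLp 2 _).comp (measurable_pi_iff.2 fun k => ?_)
    refine Fin.cases ?_ (fun k => ?_) k
    · exact measurable_fst.fst
    · refine Fin.cases ?_ (fun k => ?_) k
      · exact measurable_fst.snd
      · simp only [Fin.cons_succ]
        fun_prop

theorem measurePreserving_splitPair (d n : ℕ) :
    MeasurePreserving (splitPair d n) volume volume :=
  ((measurePreserving_prodAssoc (volume : Measure (Rd d)) (volume : Measure (Rd d))
    (volume : Measure (Conf d n))).symm _).comp
    (((MeasurePreserving.id volume).prod (measurePreserving_split d n)).comp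
      (measurePreserving_split d (n + 1)))

/-- The configuration with the given positions of the first two and of the other particles. -/
noncomputable def joinPair (d n : ℕ) (q : (Rd d × Rd d) × Conf d n) : Conf d (n + 2) :=
  (splitPair d n).symm q

theorem measurePreserving_joinPair (d n : ℕ) :
    MeasurePreserving (joinPair d n) volume volume :=
  (measurePreserving_splitPair d n).symm

theorem joinPair_add (q q' : (Rd d × Rd d) × Conf d n) :
    joinPair d n (q + q') = joinPair d n q + joinPair d n q' := by
  refine (splitPair d n).injective ?_
  rw [joinPair, MeasurableEquiv.apply_symm_apply]
  rfl

theorem joinPair_smul (c : ℝ) (q : (Rd d × Rd d) × Conf d n) :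
    joinPair d n (c • q) = c • joinPair d n q := by
  refine (splitPair d n).injective ?_
  rw [joinPair, MeasurableEquiv.apply_symm_apply]
  rfl

theorem continuous_joinPair (d n : ℕ) : Continuous (joinPair d n) := by
  refine (PiLp.continuous_toLp 2 _).comp (continuous_pi fun k => ?_)
  refine Fin.cases ?_ (fun k => ?_) k
  · exact continuous_fst.fst
  · refine Fin.cases ?_ (fun k => ?_) k
    · exact continuous_fst.snd
    · simp only [Fin.cons_succ]
      fun_prop

/-! ### Translations -/

/-- Translation of wave functions, `ψ ↦ ψ(· + v)`. -/
noncomputable def translate (v : Conf d n) : L2n d n →ₗᵢ[ℂ] L2n d n :=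
  Lp.compMeasurePreservingₗᵢ ℂ (fun x => x + v) (measurePreserving_add_right volume v)

theorem translate_coeFn (v : Conf d n) (ψ : L2n d n) :
    translate v ψ =ᵐ[volume] fun x => ψ (x + v) :=
  Lp.coeFn_compMeasurePreserving ψ (measurePreserving_add_right volume v)

theorem translate_zero (ψ : L2n d n) : translate 0 ψ = ψ := by
  refine Lp.ext ?_
  filter_upwards [translate_coeFn 0 ψ] with x hx
  rw [hx, add_zero]

theorem continuous_translate (ψ : L2n d n) : Continuous fun v : Conf d n => translate v ψ := by
  let g : C(Conf d n, C(Conf d n, Conf d n)) :=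
    (ContinuousMap.mk (fun a : Conf d n × Conf d n => a.2 + a.1) (by fun_prop)).curry
  exact Continuous.compMeasurePreservingLp (f := fun _ => ψ) (g := g) continuous_const g.continuous
    (fun v => measurePreserving_add_right volume v) (by norm_num)

/-! ### Gaussian kernels -/

theorem gaussian_nonneg (σ : ℝ) (x y : Rd d) : 0 ≤ gaussian σ x y := by
  unfold gaussian; positivity

theorem continuous_gaussian (σ : ℝ) (x : Rd d) : Continuous (gaussian σ x) := by
  unfold gaussian; fun_prop

theorem gaussian_scale {σ : ℝ} (hσ : 0 < σ) (x w : Rd d) :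
    σ ^ d * gaussian σ x (x + σ • w) = gaussian 1 0 w := by
  have h1 : Real.exp (-‖x + σ • w - x‖ ^ 2 / (2 * σ ^ 2)) = Real.exp (-‖w‖ ^ 2 / 2) := by
    rw [add_sub_cancel_left, norm_smul, Real.norm_of_nonneg hσ.le, mul_pow]
    congr 1
    field_simp
  have h2 : (2 * Real.pi * σ ^ 2) ^ ((d : ℝ) / 2) = (2 * Real.pi) ^ ((d : ℝ) / 2) * σ ^ d := by
    rw [Real.mul_rpow (by positivity) (by positivity), ← Real.rpow_natCast σ 2,
      ← Real.rpow_mul hσ.le, show ((2 : ℕ) : ℝ) * ((d : ℝ) / 2) = d by push_cast; ring,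
      Real.rpow_natCast]
  unfold gaussian
  rw [h1, h2, sub_zero, one_pow, mul_one, mul_one]
  field_simp

theorem integral_gaussian_one (d : ℕ) : ∫ w : Rd d, gaussian 1 0 w = 1 := by
  have h := GaussianFourier.integral_rexp_neg_mul_sq_norm (V := Rd d) (b := 1 / 2) (by norm_num)
  unfold gaussian
  rw [integral_const_mul]
  have h2 : ∀ w : Rd d, Real.exp (-‖w - 0‖ ^ 2 / (2 * 1 ^ 2)) = Real.exp (-(1 / 2) * ‖w‖ ^ 2) := by
    intro w
    rw [sub_zero]; congr 1; ring
  simp only [h2, h]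
  rw [finrank_euclideanSpace_fin, one_pow, mul_one, div_div_eq_mul_div, div_one,
    mul_comm Real.pi 2]
  exact one_div_mul_cancel (by positivity)

/-- The product of two standard Gaussians. -/
noncomputable def pairKernel (d : ℕ) (w : Rd d × Rd d) : ℝ :=
  gaussian 1 0 w.1 * gaussian 1 0 w.2

theorem pairKernel_nonneg (w : Rd d × Rd d) : 0 ≤ pairKernel d w :=
  mul_nonneg (gaussian_nonneg _ _ _) (gaussian_nonneg _ _ _)

theorem continuous_pairKernel (d : ℕ) : Continuous (pairKernel d) :=
  ((continuous_gaussian 1 0).comp continuous_fst).mul ((continuous_gaussian 1 0).comp continuous_snd)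

theorem integral_pairKernel (d : ℕ) : ∫ w, pairKernel d w = 1 := by
  rw [Measure.volume_eq_prod]
  exact (integral_prod_mul (gaussian 1 0) (gaussian 1 0)).trans (by simp [integral_gaussian_one])

theorem integrable_pairKernel (d : ℕ) : Integrable (pairKernel d) :=
  Integrable.of_integral_ne_zero (by simp [integral_pairKernel])

/-- The substitution `v = p + σw`, with Jacobian `σ^{2d}`, moves `σ` from the kernel into the
translation, so that a fixed integrable kernel can dominate as `σ → 0`. -/
theorem integral_gaussian_mul_gaussian {σ : ℝ} (hσ : 0 < σ) (p : Rd d × Rd d)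
    (f : Rd d × Rd d → ℂ) :
    ∫ v, ((gaussian σ p.1 v.1 * gaussian σ p.2 v.2 : ℝ) : ℂ) * f v =
      ∫ w, (pairKernel d w : ℂ) * f (p + σ • w) := by
  have := isAddHaarMeasure_volume_prod (Rd d) (Rd d)
  set h : Rd d × Rd d → ℂ := fun v => ((gaussian σ p.1 v.1 * gaussian σ p.2 v.2 : ℝ) : ℂ) * f v
  have h1 : ∀ w, (pairKernel d w : ℂ) * f (p + σ • w) =
      ((σ ^ d * σ ^ d : ℝ) : ℂ) * h (p + σ • w) := by
    intro w
    simp only [pairKernel, h]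
    rw [← gaussian_scale hσ p.1 w.1, ← gaussian_scale hσ p.2 w.2]
    simp only [Prod.fst_add, Prod.snd_add, Prod.smul_fst, Prod.smul_snd]
    push_cast
    ring
  simp only [h1]
  rw [integral_const_mul, Measure.integral_comp_smul volume (fun w => h (p + w)) σ,
    integral_add_left_eq_self, Module.finrank_prod, finrank_euclideanSpace_fin, pow_add,
    abs_of_pos (by positivity), Complex.real_smul, ← mul_assoc, ← Complex.ofReal_mul,
    mul_inv_cancel₀ (by positivity), Complex.ofReal_one, one_mul]

/-! ### Smearing of two particles -/

theorem integrable_smear (σ : ℝ) (ψ : L2n d (n + 2)) : Integrable (fun w : Rd d × Rd d =>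
    (pairKernel d w : ℂ) • translate (joinPair d n (σ • w, 0)) ψ) := by
  refine ((integrable_pairKernel d).mul_const ‖ψ‖).mono' ?_ (Eventually.of_forall fun w => ?_)
  · refine Continuous.aestronglyMeasurable ?_
    refine (Complex.continuous_ofReal.comp (continuous_pairKernel d)).smul
      ((continuous_translate ψ).comp ((continuous_joinPair d n).comp ?_))
    fun_prop
  · rw [norm_smul, LinearIsometry.norm_map, Complex.norm_real,
      Real.norm_of_nonneg (pairKernel_nonneg w)]

/-- Convolution of a wave function with Gaussians of variance `σ²` in the first two particles. -/
noncomputable def smear (d n : ℕ) (σ : ℝ) : L2n d (n + 2) →L[ℂ] L2n d (n + 2) :=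
  LinearMap.mkContinuous
    { toFun := fun ψ => ∫ w, (pairKernel d w : ℂ) • translate (joinPair d n (σ • w, 0)) ψ
      map_add' := fun ψ φ => by
        simp only [map_add, smul_add]
        exact integral_add (integrable_smear σ ψ) (integrable_smear σ φ)
      map_smul' := fun c ψ => by
        simp only [map_smul, RingHom.id_apply]
        rw [← integral_smul]
        simp only [smul_comm c] } 1
    (fun ψ => by
      refine (norm_integral_le_of_norm_le ((integrable_pairKernel d).mul_const ‖ψ‖)
        (Eventually.of_forall fun w => ?_)).trans_eq ?_
      · rw [norm_smul, LinearIsometry.norm_map, Complex.norm_real,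
          Real.norm_of_nonneg (pairKernel_nonneg w)]
      · rw [integral_mul_const, integral_pairKernel])

theorem smear_apply (σ : ℝ) (ψ : L2n d (n + 2)) : smear d n σ ψ =
    ∫ w, (pairKernel d w : ℂ) • translate (joinPair d n (σ • w, 0)) ψ := rfl

theorem norm_smear_le (σ : ℝ) : ‖smear d n σ‖ ≤ 1 :=
  LinearMap.mkContinuous_norm_le _ zero_le_one _

/-- The kernel has mass one and translations act continuously on `L²`, so dominated convergence
applies to the `L²`-valued integral. -/
theorem tendsto_smear (ψ : L2n d (n + 2)) :
    Tendsto (fun σ => smear d n σ ψ) (𝓝 0) (𝓝 ψ) := by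
  have h : ∫ w, (pairKernel d w : ℂ) • ψ = ψ := by
    rw [integral_smul_const, integral_complex_ofReal, integral_pairKernel]
    simp
  conv => enter [3, 1]; rw [← h]
  refine tendsto_integral_filter_of_dominated_convergence (fun w => pairKernel d w * ‖ψ‖)
    (Eventually.of_forall fun σ => (integrable_smear σ ψ).1)
    (Eventually.of_forall fun σ => Eventually.of_forall fun w => ?_)
    ((integrable_pairKernel d).mul_const ‖ψ‖) (Eventually.of_forall fun w => ?_)
  · rw [norm_smul, LinearIsometry.norm_map, Complex.norm_real,
      Real.norm_of_nonneg (pairKernel_nonneg w)]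
  · refine Tendsto.const_smul ?_ _
    have hc : Continuous fun σ : ℝ => translate (joinPair d n (σ • w, 0)) ψ :=
      (continuous_translate ψ).comp ((continuous_joinPair d n).comp (by fun_prop))
    have h0 := hc.tendsto 0
    have h1 : joinPair d n ((0 : ℝ) • w, 0) = 0 := by
      have := joinPair_smul (d := d) (n := n) 0 (w, 0)
      rw [zero_smul, zero_smul] at this
      rwa [zero_smul]
    rwa [h1, translate_zero] at h0

/-- If contractions `T i` converge strongly to the identity, then so do their adjoints. -/
theorem tendsto_adjoint_of_contraction {ι E : Type*} [NormedAddCommGroup E]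
    [InnerProductSpace ℂ E] [CompleteSpace E] {l : Filter ι} {T : ι → E →L[ℂ] E}
    (hT : ∀ i, ‖T i‖ ≤ 1) (h : ∀ x, Tendsto (fun i => T i x) l (𝓝 x)) (x : E) :
    Tendsto (fun i => ContinuousLinearMap.adjoint (T i) x) l (𝓝 x) := by
  rw [tendsto_iff_norm_sub_tendsto_zero]
  -- The square `‖T*x - x‖²` is at most `2‖x‖² - 2 Re⟨x, Tx⟩`, which involves only `T`.
  have h1 : Tendsto (fun i => 2 * ‖x‖ ^ 2 - 2 * (inner ℂ x (T i x)).re) l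
      (𝓝 (2 * ‖x‖ ^ 2 - 2 * (inner ℂ x x).re)) :=
    tendsto_const_nhds.sub
      (((Complex.continuous_re.tendsto _).comp (tendsto_const_nhds.inner (h x))).const_mul 2)
  have h2 : (inner ℂ x x).re = ‖x‖ ^ 2 := inner_self_eq_norm_sq (𝕜 := ℂ) x
  rw [h2, sub_self] at h1
  have h3 : Tendsto (fun i => ‖ContinuousLinearMap.adjoint (T i) x - x‖ ^ 2) l (𝓝 0) := by
    refine squeeze_zero (fun i => by positivity) (fun i => ?_) h1
    rw [@norm_sub_sq ℂ, ContinuousLinearMap.adjoint_inner_left]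
    have h4 : ‖ContinuousLinearMap.adjoint (T i) x‖ ≤ ‖x‖ := by
      refine (ContinuousLinearMap.le_opNorm _ _).trans ?_
      rw [LinearIsometryEquiv.norm_map]
      exact mul_le_of_le_one_left (norm_nonneg _) (hT i)
    have h5 : ‖ContinuousLinearMap.adjoint (T i) x‖ ^ 2 ≤ ‖x‖ ^ 2 := by gcongr
    have h6 : RCLike.re (inner ℂ x (T i x)) = (inner ℂ x (T i x)).re := rfl
    rw [h6]
    linarith
  simpa using h3.sqrt

/-- The pointwise formula for `smear`. -/
noncomputable def smearFun (σ : ℝ) (ψ : L2n d (n + 2)) (q : (Rd d × Rd d) × Conf d n) : ℂ :=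
  ∫ w, (pairKernel d w : ℂ) * ψ (joinPair d n (q.1 + σ • w, q.2))

theorem memLp_integrableOn {X : Type*} [MeasurableSpace X] {μ : Measure X} {f : X → ℂ}
    (hf : MemLp f 2 μ) {s : Set X} (hs : μ s < ⊤) : IntegrableOn f s μ := by
  have : IsFiniteMeasure (μ.restrict s) := isFiniteMeasure_restrict.2 hs.ne
  exact (hf.restrict s).integrable (by norm_num)

theorem joinPair_shift (σ : ℝ) (w : Rd d × Rd d) (q : (Rd d × Rd d) × Conf d n) :
    joinPair d n (q.1 + σ • w, q.2) = joinPair d n q + joinPair d n (σ • w, 0) := by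
  rw [← joinPair_add]
  congr 1
  exact Prod.ext rfl (add_zero _).symm

theorem memLp_comp_shift (ψ : L2n d (n + 2)) (v : Conf d (n + 2)) :
    MemLp (fun q => ψ (joinPair d n q + v)) 2 volume :=
  (Lp.memLp ψ).comp_measurePreserving
    ((measurePreserving_add_right volume v).comp (measurePreserving_joinPair d n))

/-- From `|ψ| ≤ 1 + |ψ|²` and translation invariance. What matters is that the bound does not depend
on `v`, which justifies Fubini in the smearing integral. -/
theorem setIntegral_shift_le (ψ : L2n d (n + 2)) (v : Conf d (n + 2))
    {s : Set ((Rd d × Rd d) × Conf d n)} (hs : volume s < ⊤) :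
    ∫ q in s, ‖ψ (joinPair d n q + v)‖ ≤ volume.real s + ∫ x, ‖ψ x‖ ^ 2 := by
  have : IsFiniteMeasure (volume.restrict s) := isFiniteMeasure_restrict.2 hs.ne
  have hm := memLp_comp_shift ψ v
  have hi := (memLp_two_iff_integrable_sq_norm hm.1).1 hm
  have h1 : ∫ q in s, ‖ψ (joinPair d n q + v)‖ ≤ ∫ q in s, (1 + ‖ψ (joinPair d n q + v)‖ ^ 2) := by
    refine setIntegral_mono (memLp_integrableOn hm hs).norm
      ((integrable_const 1).add hi.integrableOn) fun q => ?_
    nlinarith [sq_nonneg (‖ψ (joinPair d n q + v)‖ - 1)]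
  refine h1.trans ?_
  rw [integral_add (integrable_const 1) hi.integrableOn]
  refine add_le_add (by simp) ?_
  refine (setIntegral_le_integral hi (Eventually.of_forall fun q => by positivity)).trans_eq ?_
  have hmp := (measurePreserving_add_right (volume : Measure (Conf d (n + 2))) v)
  rw [(measurePreserving_joinPair d n).integral_comp (splitPair d n).symm.measurableEmbedding
    (fun x => ‖ψ (x + v)‖ ^ 2)]
  exact integral_add_right_eq_self (fun x => ‖ψ x‖ ^ 2) v

theorem integrable_smearFun_integrand (σ : ℝ) (ψ : L2n d (n + 2))
    {s : Set ((Rd d × Rd d) × Conf d n)} (hs : volume s < ⊤) :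
    Integrable (fun p : (Rd d × Rd d) × ((Rd d × Rd d) × Conf d n) =>
      (pairKernel d p.1 : ℂ) * ψ (joinPair d n (p.2.1 + σ • p.1, p.2.2)))
      ((volume : Measure (Rd d × Rd d)).prod (volume.restrict s)) := by
  have hmeas : StronglyMeasurable (fun p : (Rd d × Rd d) × ((Rd d × Rd d) × Conf d n) =>
      (pairKernel d p.1 : ℂ) * ψ (joinPair d n (p.2.1 + σ • p.1, p.2.2))) := by
    refine ((Complex.continuous_ofReal.comp (continuous_pairKernel d)).stronglyMeasurable.comp_measurable
      measurable_fst).mul ((Lp.stronglyMeasurable ψ).comp_measurable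
        ((measurePreserving_joinPair d n).measurable.comp ?_))
    fun_prop
  rw [integrable_prod_iff hmeas.aestronglyMeasurable]
  simp only [joinPair_shift σ]
  refine ⟨Eventually.of_forall fun w =>
    (memLp_integrableOn (memLp_comp_shift ψ _) hs).const_mul _, ?_⟩
  refine ((integrable_pairKernel d).mul_const (volume.real s + ∫ x, ‖ψ x‖ ^ 2)).mono' ?_ ?_
  · have := hmeas.norm.integral_prod_right' (ν := volume.restrict s)
    simp only [joinPair_shift σ] at this
    exact this.aestronglyMeasurable
  · refine Eventually.of_forall fun w => ?_
    rw [Real.norm_of_nonneg (integral_nonneg fun q => norm_nonneg _)]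
    simp only [norm_mul, Complex.norm_real, Real.norm_of_nonneg (pairKernel_nonneg w)]
    rw [integral_const_mul]
    exact mul_le_mul_of_nonneg_left (setIntegral_shift_le ψ _ hs) (pairKernel_nonneg w)

/-- An `L²`-valued integral has the pointwise integral as its representative. Both sides are
integrated over sets of finite measure: pairing with an indicator commutes with the `L²`-valued
integral, and Fubini exchanges the order. -/
theorem smear_joinPair (σ : ℝ) (ψ : L2n d (n + 2)) :
    (fun q => smear d n σ ψ (joinPair d n q)) =ᵐ[volume] smearFun σ ψ := by
  refine ae_eq_of_forall_setIntegral_eq_of_sigmaFinite (fun s _ hs => memLp_integrableOn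
    ((Lp.memLp (smear d n σ ψ)).comp_measurePreserving (measurePreserving_joinPair d n)) hs)
    (fun s _ hs => (integrable_smearFun_integrand σ ψ hs).integral_prod_right) fun s hsm hs => ?_
  have hemb := (splitPair d n).symm.measurableEmbedding
  have hset : ∀ f : Conf d (n + 2) → ℂ, ∫ q in s, f (joinPair d n q) =
      ∫ x in (splitPair d n) ⁻¹' s, f x := by
    intro f
    rw [← (measurePreserving_joinPair d n).setIntegral_preimage_emb hemb, ← Set.preimage_comp]
    congr 2
  have hs' : volume ((splitPair d n) ⁻¹' s) ≠ ⊤ := by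
    rw [(measurePreserving_splitPair d n).measure_preimage hsm.nullMeasurableSet]
    exact hs.ne
  have hsm' : MeasurableSet ((splitPair d n) ⁻¹' s) := (splitPair d n).measurable hsm
  rw [hset, ← L2.inner_indicatorConstLp_one hsm' hs', smear_apply,
    ← integral_inner (integrable_smear σ ψ)]
  have h1 : ∀ w, inner ℂ (indicatorConstLp 2 hsm' hs' (1 : ℂ))
      ((pairKernel d w : ℂ) • translate (joinPair d n (σ • w, 0)) ψ) =
      ∫ q in s, (pairKernel d w : ℂ) * ψ (joinPair d n (q.1 + σ • w, q.2)) := by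
    intro w
    rw [inner_smul_right, L2.inner_indicatorConstLp_one, integral_const_mul]
    congr 1
    rw [setIntegral_congr_ae (g := fun x => ψ (x + joinPair d n (σ • w, 0))) hsm'
      ((translate_coeFn _ ψ).mono fun x hx _ => hx),
      ← hset (fun x => ψ (x + joinPair d n (σ • w, 0)))]
    simp only [joinPair_shift σ]
  simp only [h1]
  exact integral_integral_swap (integrable_smearFun_integrand σ ψ hs)

end Smearing
-- The smeared interaction as a conjugated multiplication operator.
section Annihilation

variable {d n : ℕ}

theorem fullCreate_coeFn (f : L2 d) (ψ : L2n d n) : fullCreate f n ψ =ᵐ[volume] fun x =>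
    ((Real.sqrt (n + 1) : ℝ) : ℂ) * (f (x 0) * ψ (WithLp.toLp 2 fun k => x k.succ)) := by
  change (((Real.sqrt (n + 1) : ℝ) : ℂ) • (memLp_tensor f ψ).toLp : L2n d (n + 1)) =ᵐ[volume] _
  filter_upwards [Lp.coeFn_smul ((Real.sqrt (n + 1) : ℝ) : ℂ) (memLp_tensor f ψ).toLp,
    (memLp_tensor f ψ).coeFn_toLp] with x h1 h2
  rw [h1, Pi.smul_apply, h2, smul_eq_mul]

/-- The permutation of `n + 1` particles that fixes the first one. -/
def extendPerm (π : Equiv.Perm (Fin n)) : Equiv.Perm (Fin (n + 1)) :=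
  Equiv.Perm.decomposeFin.symm (0, π)

theorem sign_extendPerm (π : Equiv.Perm (Fin n)) :
    Equiv.Perm.sign (extendPerm π) = Equiv.Perm.sign π := by
  simp [extendPerm]

theorem extendPerm_symm_zero (π : Equiv.Perm (Fin n)) : (extendPerm π).symm 0 = 0 := by
  rw [Equiv.symm_apply_eq]
  simp [extendPerm]

theorem extendPerm_symm_succ (π : Equiv.Perm (Fin n)) (k : Fin n) :
    (extendPerm π).symm k.succ = (π.symm k).succ := by
  rw [Equiv.symm_apply_eq]
  simp [extendPerm]

theorem fullCreate_permL2 (f : L2 d) (π : Equiv.Perm (Fin n)) (ψ : L2n d n) :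
    fullCreate f n (permL2 d π ψ) = permL2 d (extendPerm π) (fullCreate f n ψ) := by
  refine Lp.ext ?_
  filter_upwards [fullCreate_coeFn f (permL2 d π ψ), ae_tail (permL2_coeFn π ψ),
    permL2_coeFn (extendPerm π) (fullCreate f n ψ),
    (permConf d (extendPerm π)).measurePreserving.quasiMeasurePreserving.ae
      (fullCreate_coeFn f ψ)] with x h1 h2 h3 h4
  rw [h1, h2, h3, h4, permConf_apply, extendPerm_symm_zero]
  simp only [permConf_apply, extendPerm_symm_succ]
  rfl

/-- Creation intertwines `π` with its extension fixing the new particle, and that extension has the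
same sign. Taking adjoints shows that the projection in `annihilate` acts trivially. -/
theorem fullAnnihilate_mem (f : L2 d) {ψ : L2n d (n + 1)} (hψ : ψ ∈ antisym d (n + 1)) :
    fullAnnihilate f n ψ ∈ antisym d n := by
  rw [mem_antisym]
  intro π
  refine ext_inner_left ℂ fun φ => ?_
  have h1 : φ = permL2 d π (permL2 d π⁻¹ φ) := by
    rw [permL2_permL2, inv_mul_cancel, permL2_one]
  conv_lhs => rw [h1]
  rw [inner_permL2_permL2, inner_smul_right, fullAnnihilate,
    ContinuousLinearMap.adjoint_inner_right, ContinuousLinearMap.adjoint_inner_right,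
    fullCreate_permL2, ← inner_conj_symm, inner_permL2_of_mem hψ, map_mul, inner_conj_symm,
    sign_extendPerm, map_intCast, Equiv.Perm.sign_inv]

theorem coe_annihilate (f : L2 d) (ψ : antisym d (n + 1)) :
    (annihilate f n ψ : L2n d n) = fullAnnihilate f n ψ := by
  change ((antisymProj d n (fullAnnihilate f n (ψ : L2n d (n + 1))) : antisym d n) : L2n d n) = _
  rw [antisymProj_of_mem (fullAnnihilate_mem f ψ.2)]

/-- The normalization of two successive creations. -/
noncomputable def pairConst (n : ℕ) : ℝ := Real.sqrt ((n + 1 : ℕ) + 1) * Real.sqrt (n + 1)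

theorem pairConst_sq (n : ℕ) : pairConst n * pairConst n = (n + 1) * (n + 2) := by
  have h1 := Real.mul_self_sqrt (show (0 : ℝ) ≤ (n + 1 : ℕ) + 1 by positivity)
  have h2 := Real.mul_self_sqrt (show (0 : ℝ) ≤ (n : ℝ) + 1 by positivity)
  rw [pairConst, mul_mul_mul_comm, h1, h2]
  push_cast
  ring

theorem gaussianL2_coeFn {σ : ℝ} (hσ : 0 < σ) (x : Rd d) :
    gaussianL2 hσ x =ᵐ[volume] fun y => (gaussian σ x y : ℂ) :=
  (memLp_gaussian hσ x).coeFn_toLp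

theorem ae_head {p : Rd d → Prop} (h : ∀ᵐ y, p y) : ∀ᵐ x : Conf d (n + 1), p (x 0) :=
  ((Measure.quasiMeasurePreserving_fst (ν := (volume : Measure (Conf d n)))).comp
    (measurePreserving_split d n).quasiMeasurePreserving).ae h

theorem fullCreate_fullCreate_joinPair {σ : ℝ} (hσ : 0 < σ) (p : Rd d × Rd d) (φ : L2n d n) :
    ∀ᵐ q, fullCreate (gaussianL2 hσ p.1) (n + 1) (fullCreate (gaussianL2 hσ p.2) n φ)
      (joinPair d n q) = (pairConst n : ℂ) *
        (((gaussian σ p.1 q.1.1 * gaussian σ p.2 q.1.2 : ℝ) : ℂ) * φ q.2) := by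
  have h : ∀ᵐ x : Conf d (n + 2),
      fullCreate (gaussianL2 hσ p.1) (n + 1) (fullCreate (gaussianL2 hσ p.2) n φ) x =
        (pairConst n : ℂ) * (((gaussian σ p.1 (x 0) * gaussian σ p.2 (x 1) : ℝ) : ℂ) *
          φ (WithLp.toLp 2 fun k => x k.succ.succ)) := by
    filter_upwards [fullCreate_coeFn (gaussianL2 hσ p.1) (fullCreate (gaussianL2 hσ p.2) n φ),
      ae_tail (fullCreate_coeFn (gaussianL2 hσ p.2) φ), ae_head (gaussianL2_coeFn hσ p.1),
      ae_tail (ae_head (gaussianL2_coeFn hσ p.2))] with x h1 h2 h3 h4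
    rw [h1, h2, h3, h4, pairConst]
    simp only [Fin.succ_zero_eq_one]
    push_cast
    ring
  filter_upwards [(measurePreserving_joinPair d n).quasiMeasurePreserving.ae h] with q hq
  rw [hq]
  rfl

/-- Integrating out the first two particles against Gaussians centered at `p` is smearing evaluated
at `p`. The explicit function `smearFun` is used because the identity is needed for each fixed `p`,
where an `L²` class has no value. The proof pairs both sides with indicators, which turns
annihilations into creations. -/
theorem fullAnnihilate_fullAnnihilate {σ : ℝ} (hσ : 0 < σ) (p : Rd d × Rd d)
    (ψ : L2n d (n + 2)) :
    fullAnnihilate (gaussianL2 hσ p.2) n (fullAnnihilate (gaussianL2 hσ p.1) (n + 1) ψ) =ᵐ[volume]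
      fun z => (pairConst n : ℂ) * smearFun σ ψ (p, z) := by
  let h : (Rd d × Rd d) → Conf d n → ℂ := fun v z => (pairConst n : ℂ) *
    (((gaussian σ p.1 v.1 * gaussian σ p.2 v.2 : ℝ) : ℂ) * ψ (joinPair d n (v, z)))
  have hint : ∀ z, ∫ v, h v z = (pairConst n : ℂ) * smearFun σ ψ (p, z) := by
    intro z
    rw [integral_const_mul, integral_gaussian_mul_gaussian hσ]
    rfl
  have key : ∀ s : Set (Conf d n), MeasurableSet s → volume s < ⊤ →
      IntegrableOn (fun z => (pairConst n : ℂ) * smearFun σ ψ (p, z)) s ∧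
      ∫ z in s, fullAnnihilate (gaussianL2 hσ p.2) n
        (fullAnnihilate (gaussianL2 hσ p.1) (n + 1) ψ) z =
        ∫ z in s, (pairConst n : ℂ) * smearFun σ ψ (p, z) := by
    intro s hsm hs
    set e : L2n d n := indicatorConstLp 2 hsm hs.ne (1 : ℂ) with he
    set Ce := fullCreate (gaussianL2 hσ p.1) (n + 1) (fullCreate (gaussianL2 hσ p.2) n e) with hCe
    have hemb := (splitPair d n).symm.measurableEmbedding
    have hmp := measurePreserving_joinPair d n
    have heq : (fun q => inner ℂ (Ce (joinPair d n q)) (ψ (joinPair d n q))) =ᵐ[volume]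
        fun q => s.indicator (fun z => h q.1 z) q.2 := by
      filter_upwards [fullCreate_fullCreate_joinPair hσ p e,
        (Measure.quasiMeasurePreserving_snd (μ := (volume : Measure (Rd d × Rd d)))).ae
          (indicatorConstLp_coeFn (p := 2) (hs := hsm) (hμs := hs.ne) (c := (1 : ℂ)))] with q h1 h2
      rw [h1, h2]
      by_cases hq : q.2 ∈ s
      · simp only [RCLike.inner_apply, Set.indicator_of_mem hq, map_mul, Complex.conj_ofReal, h,
          map_one]
        ring
      · simp only [RCLike.inner_apply, Set.indicator_of_notMem hq, mul_zero, map_zero]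
    have hI : Integrable (fun q : (Rd d × Rd d) × Conf d n =>
        s.indicator (fun z => h q.1 z) q.2) volume :=
      ((hmp.integrable_comp_emb hemb).2 (L2.integrable_inner (𝕜 := ℂ) Ce ψ)).congr heq
    have hind : ∀ z, ∫ v, s.indicator (fun z => h v z) z =
        s.indicator (fun z => (pairConst n : ℂ) * smearFun σ ψ (p, z)) z := by
      intro z
      by_cases hz : z ∈ s
      · simp only [Set.indicator_of_mem hz, hint]
      · simp only [Set.indicator_of_notMem hz, integral_zero]
    constructor
    · have h1 := Integrable.integral_prod_right (f := fun q : (Rd d × Rd d) × Conf d n =>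
        s.indicator (fun z => h q.1 z) q.2) hI
      simp only [hind] at h1
      exact (integrable_indicator_iff hsm).1 h1
    · rw [← L2.inner_indicatorConstLp_one hsm hs.ne, ← he, fullAnnihilate, fullAnnihilate,
        ContinuousLinearMap.adjoint_inner_right, ContinuousLinearMap.adjoint_inner_right, ← hCe,
        L2.inner_def, ← hmp.integral_comp hemb, integral_congr_ae heq]
      refine (integral_prod_symm (fun q : (Rd d × Rd d) × Conf d n =>
        s.indicator (fun z => h q.1 z) q.2) hI).trans ?_
      simp only [hind]
      rw [integral_indicator hsm]
  exact ae_eq_of_forall_setIntegral_eq_of_sigmaFinite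
    (fun s _ hs => memLp_integrableOn (Lp.memLp _) hs) (fun s hsm hs => (key s hsm hs).1)
    fun s hsm hs => (key s hsm hs).2

/-- The centers `p` and the remaining variables `z` together form a full configuration. By Fubini,
the `p`-integral of inner products over `z` is one inner product over all particles, in which
`W_Λ(p)` becomes the potential of the first two. -/
theorem integral_pairPotential_mul_inner {Λ : Set (Rd d)} {W : Rd d → ℝ} (hW : MemLp W ⊤ volume)
    (hΛ : NullMeasurableSet Λ volume) {σ : ℝ} (hσ : 0 < σ) (χ ψ : L2n d (n + 2)) :
    let B : Rd d × Rd d → L2n d (n + 2) → L2n d n := fun p ψ =>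
      fullAnnihilate (gaussianL2 hσ p.2) n (fullAnnihilate (gaussianL2 hσ p.1) (n + 1) ψ)
    Integrable (fun p => (pairPotential Λ W p : ℂ) * inner ℂ (B p χ) (B p ψ)) ∧
    ((pairConst n * pairConst n : ℝ) : ℂ) * inner ℂ (smear d n σ χ)
        (mulOp (fun x : Conf d (n + 2) => pairPotential Λ W (x 0, x 1)) (smear d n σ ψ)) =
      ∫ p, (pairPotential Λ W p : ℂ) * inner ℂ (B p χ) (B p ψ) := by
  intro B
  have h01 : (0 : Fin (n + 2)) ≠ 1 := by simp
  set M := mulOp (fun x : Conf d (n + 2) => pairPotential Λ W (x 0, x 1)) with hM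
  have hemb := (splitPair d n).symm.measurableEmbedding
  have hmp := measurePreserving_joinPair d n
  let h : (Rd d × Rd d) → Conf d n → ℂ := fun p z => ((pairConst n * pairConst n : ℝ) : ℂ) *
    ((pairPotential Λ W p : ℂ) * (smearFun σ ψ (p, z) * (starRingEnd ℂ) (smearFun σ χ (p, z))))
  have heq : (fun q => ((pairConst n * pairConst n : ℝ) : ℂ) *
      inner ℂ (smear d n σ χ (joinPair d n q)) (M (smear d n σ ψ) (joinPair d n q)))
        =ᵐ[volume] fun q => h q.1 q.2 := by
    filter_upwards [smear_joinPair σ χ, smear_joinPair σ ψ, hmp.quasiMeasurePreserving.ae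
      (mulOp_coeFn (memLp_pairPotential_comp hW hΛ h01) (smear d n σ ψ))] with q h1 h2 h3
    rw [h3, h1, h2, RCLike.inner_apply, mul_assoc]
    rfl
  have hI : Integrable (fun q : (Rd d × Rd d) × Conf d n => h q.1 q.2) volume :=
    (((hmp.integrable_comp_emb hemb).2
      (L2.integrable_inner (𝕜 := ℂ) (smear d n σ χ) (M (smear d n σ ψ)))).const_mul _).congr heq
  have hB : ∀ p, ∫ z, h p z = (pairPotential Λ W p : ℂ) * inner ℂ (B p χ) (B p ψ) := by
    intro p
    rw [L2.inner_def, ← integral_const_mul]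
    refine integral_congr_ae ?_
    filter_upwards [fullAnnihilate_fullAnnihilate hσ p χ, fullAnnihilate_fullAnnihilate hσ p ψ]
      with z h1 h2
    simp only [B]
    rw [h1, h2, RCLike.inner_apply, map_mul, Complex.conj_ofReal]
    simp only [h]
    push_cast
    ring
  constructor
  · have h1 := Integrable.integral_prod_left
      (f := fun q : (Rd d × Rd d) × Conf d n => h q.1 q.2) hI
    simpa only [hB] using h1
  · rw [L2.inner_def, ← hmp.integral_comp hemb, ← integral_const_mul, integral_congr_ae heq]
    refine (integral_prod (fun q : (Rd d × Rd d) × Conf d n => h q.1 q.2) hI).trans ?_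
    simp only [hB]

/-- The compression of `B* M B` to the antisymmetric subspace. -/
noncomputable def sandwich {m : ℕ} (B M : L2n d m →L[ℂ] L2n d m) : antisym d m →L[ℂ] antisym d m :=
  antisymProj d m ∘L ContinuousLinearMap.adjoint B ∘L M ∘L B ∘L (antisym d m).subtypeL

theorem inner_smul_sandwich {m : ℕ} (B M : L2n d m →L[ℂ] L2n d m) (c : ℂ) (χ φ : antisym d m) :
    inner ℂ χ ((c • sandwich B M) φ) =
      c * inner ℂ (B (χ : L2n d m)) (M (B (φ : L2n d m))) := by
  have h : sandwich B M φ = antisymProj d m (ContinuousLinearMap.adjoint B (M (B φ))) := rfl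
  rw [smul_apply, inner_smul_right, h, inner_antisymProj_right,
    ContinuousLinearMap.adjoint_inner_right]

/-- The smeared interaction as multiplication by the pair potential, conjugated with `smear`. -/
theorem smearedInteraction_eq {Λ : Set (Rd d)} {W : Rd d → ℝ} (hW : MemLp W ⊤ volume)
    (hΛ : NullMeasurableSet Λ volume) {σ : ℝ} (hσ : 0 < σ) (n : ℕ) (ψ : antisym d (n + 2)) :
    smearedInteraction Λ W hσ (n + 2) ψ = (((n + 1) * (n + 2) / 2 : ℝ) : ℂ) •
      antisymProj d (n + 2) (ContinuousLinearMap.adjoint (smear d n σ)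
        (mulOp (fun x : Conf d (n + 2) => pairPotential Λ W (x 0, x 1)) (smear d n σ ψ))) := by
  let S : antisym d (n + 2) →L[ℂ] antisym d (n + 2) :=
    ((pairConst n * pairConst n : ℝ) : ℂ) •
      sandwich (smear d n σ) (mulOp fun x : Conf d (n + 2) => pairPotential Λ W (x 0, x 1))
  have hS : IsWeakIntegral (volume : Measure (Rd d × Rd d)) (fun p =>
      (pairPotential Λ W p : ℂ) •
        (create (gaussianL2 hσ p.1) (n + 1) ∘L create (gaussianL2 hσ p.2) n ∘L
          annihilate (gaussianL2 hσ p.2) n ∘L annihilate (gaussianL2 hσ p.1) (n + 1))) S := by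
    intro χ φ
    have h := integral_pairPotential_mul_inner hW hΛ hσ (χ : L2n d (n + 2)) (φ : L2n d (n + 2))
    have hp : ∀ p : Rd d × Rd d, inner ℂ χ (((pairPotential Λ W p : ℂ) •
        (create (gaussianL2 hσ p.1) (n + 1) ∘L create (gaussianL2 hσ p.2) n ∘L
          annihilate (gaussianL2 hσ p.2) n ∘L annihilate (gaussianL2 hσ p.1) (n + 1))) φ) =
        (pairPotential Λ W p : ℂ) * inner ℂ
          (fullAnnihilate (gaussianL2 hσ p.2) n
            (fullAnnihilate (gaussianL2 hσ p.1) (n + 1) (χ : L2n d (n + 2))))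
          (fullAnnihilate (gaussianL2 hσ p.2) n
            (fullAnnihilate (gaussianL2 hσ p.1) (n + 1) (φ : L2n d (n + 2)))) := by
      intro p
      rw [smul_apply, inner_smul_right, inner_create_create, Submodule.coe_inner, coe_annihilate,
        coe_annihilate, coe_annihilate, coe_annihilate]
    simp only [hp]
    refine ⟨h.1, ?_⟩
    rw [← h.2]
    exact inner_smul_sandwich _ _ _ χ φ
  rw [smearedInteraction, weakIntegral_eq hS]
  change (1 / 2 : ℂ) • (((pairConst n * pairConst n : ℝ) : ℂ) • antisymProj d (n + 2)
      (ContinuousLinearMap.adjoint (smear d n σ)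
        (mulOp (fun x : Conf d (n + 2) => pairPotential Λ W (x 0, x 1))
          (smear d n σ (ψ : L2n d (n + 2)))))) = _
  rw [pairConst_sq, smul_smul]
  congr 1
  push_cast
  ring

theorem tendsto_interaction_of_eq {Λ : Set (Rd d)} {W : Rd d → ℝ} {n : ℕ}
    {F : ℝ → antisym d n →L[ℂ] antisym d n}
    (hF : ∀ σ : ℝ, ∀ hσ : 0 < σ, ∀ ψ, smearedInteraction Λ W hσ n ψ = F σ ψ)
    (hlim : ∀ ψ, Tendsto (fun σ => F σ ψ) (𝓝 0) (𝓝 (pointInteraction Λ W n ψ)))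
    (hb : ∃ C : ℝ, ∀ σ ψ, ‖F σ ψ‖ ≤ C * ‖ψ‖) :
    (∃ C : ℝ, ∀ σ : ℝ, 0 ≤ σ → ∀ ψ, ‖interaction Λ W σ n ψ‖ ≤ C * ‖ψ‖) ∧
    ∀ ψ, Tendsto (fun σ => interaction Λ W σ n ψ) (𝓝[>] 0) (𝓝 (interaction Λ W 0 n ψ)) := by
  have hpos : ∀ {σ : ℝ} (hσ : 0 < σ), interaction Λ W σ n = smearedInteraction Λ W hσ n :=
    fun hσ => by rw [interaction, dif_pos hσ]
  have hzero : interaction Λ W 0 n = pointInteraction Λ W n := by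
    rw [interaction, dif_neg (lt_irrefl 0)]
  obtain ⟨C, hC⟩ := hb
  constructor
  · refine ⟨C, fun σ hσ ψ => ?_⟩
    rcases hσ.eq_or_lt with rfl | hσ
    · rw [hzero]
      -- At `σ = 0` the bound is inherited from the strong limit.
      exact le_of_tendsto (hlim ψ).norm (Eventually.of_forall fun σ => hC σ ψ)
    · rw [hpos hσ, hF σ hσ]
      exact hC σ ψ
  · intro ψ
    rw [hzero]
    refine ((hlim ψ).mono_left nhdsWithin_le_nhds).congr' ?_
    filter_upwards [self_mem_nhdsWithin] with σ hσ
    rw [hpos hσ, hF σ hσ]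

/-- The smeared interactions converge strongly to the point interaction on every sector, and are
uniformly bounded. -/
theorem tendsto_interaction {Λ : Set (Rd d)} {W : Rd d → ℝ} (hW : MemLp W ⊤ volume)
    (hΛ : NullMeasurableSet Λ volume) (n : ℕ) :
    (∃ C : ℝ, ∀ σ : ℝ, 0 ≤ σ → ∀ ψ, ‖interaction Λ W σ n ψ‖ ≤ C * ‖ψ‖) ∧
    ∀ ψ, Tendsto (fun σ => interaction Λ W σ n ψ) (𝓝[>] 0) (𝓝 (interaction Λ W 0 n ψ)) := by
  match n with
  | 0 =>
    refine tendsto_interaction_of_eq (F := fun _ => 0) (fun σ hσ ψ => rfl) (fun ψ => ?_) ⟨0, fun σ ψ => by simp⟩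
    rw [pointInteraction_of_le_one Λ W (by norm_num)]
    exact tendsto_const_nhds
  | 1 =>
    refine tendsto_interaction_of_eq (F := fun _ => 0) (fun σ hσ ψ => rfl) (fun ψ => ?_) ⟨0, fun σ ψ => by simp⟩
    rw [pointInteraction_of_le_one Λ W le_rfl]
    exact tendsto_const_nhds
  | n + 2 =>
    set M := mulOp (fun x : Conf d (n + 2) => pairPotential Λ W (x 0, x 1)) with hM
    set c : ℂ := (((n + 1) * (n + 2) / 2 : ℝ) : ℂ) with hc
    have hadj : ∀ σ : ℝ, ∀ x, ‖ContinuousLinearMap.adjoint (smear d n σ) x‖ ≤ ‖x‖ := by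
      intro σ x
      refine (ContinuousLinearMap.le_opNorm _ _).trans ?_
      rw [LinearIsometryEquiv.norm_map]
      exact mul_le_of_le_one_left (norm_nonneg _) (norm_smear_le σ)
    have hs : ∀ σ : ℝ, ∀ x, ‖smear d n σ x‖ ≤ ‖x‖ := fun σ x =>
      (ContinuousLinearMap.le_opNorm _ _).trans
        (mul_le_of_le_one_left (norm_nonneg _) (norm_smear_le σ))
    refine tendsto_interaction_of_eq (F := fun σ => c • (antisymProj d (n + 2) ∘L
      ContinuousLinearMap.adjoint (smear d n σ) ∘L M ∘L smear d n σ ∘L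
      (antisym d (n + 2)).subtypeL)) (fun σ hσ ψ => smearedInteraction_eq hW hΛ hσ n ψ) ?_ ?_
    · intro ψ
      rw [pointInteraction_eq hW hΛ]
      change Tendsto (fun σ => c • antisymProj d (n + 2)
        (ContinuousLinearMap.adjoint (smear d n σ) (M (smear d n σ (ψ : L2n d (n + 2)))))) (𝓝 0)
        (𝓝 (c • antisymProj d (n + 2) (M (ψ : L2n d (n + 2)))))
      refine Tendsto.const_smul (((antisymProj d (n + 2)).continuous.tendsto _).comp ?_) c
      have h1 := tendsto_adjoint_of_contraction norm_smear_le tendsto_smear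
        (M (ψ : L2n d (n + 2)))
      -- The splitting `S*MSψ = S*(MSψ - Mψ) + S*Mψ` uses contractivity of `S*` on the first term
      -- and its strong convergence on the second.
      have h2 : Tendsto (fun σ => ContinuousLinearMap.adjoint (smear d n σ)
          (M (smear d n σ (ψ : L2n d (n + 2))) - M (ψ : L2n d (n + 2)))) (𝓝 0) (𝓝 0) := by
        refine squeeze_zero_norm (fun σ => hadj σ _) ?_
        have h3 := (M.continuous.tendsto _).comp (tendsto_smear (ψ : L2n d (n + 2)))
        simpa using (h3.sub_const (M (ψ : L2n d (n + 2)))).norm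
      have h4 := h2.add h1
      rw [zero_add] at h4
      refine h4.congr fun σ => ?_
      rw [map_sub, sub_add_cancel]
    · refine ⟨‖c‖ * ‖antisymProj d (n + 2)‖ * ‖M‖, fun σ ψ => ?_⟩
      change ‖c • antisymProj d (n + 2)
        (ContinuousLinearMap.adjoint (smear d n σ) (M (smear d n σ (ψ : L2n d (n + 2)))))‖ ≤ _
      rw [norm_smul, mul_assoc, mul_assoc]
      refine mul_le_mul_of_nonneg_left ?_ (norm_nonneg c)
      refine (ContinuousLinearMap.le_opNorm _ _).trans ?_
      refine mul_le_mul_of_nonneg_left ?_ (by positivity)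
      refine (hadj σ _).trans ((ContinuousLinearMap.le_opNorm _ _).trans ?_)
      exact mul_le_mul_of_nonneg_left (hs σ _) (norm_nonneg _)

end Annihilation
-- From strong convergence on sectors to convergence of the propagators.
section Convergence

variable {G : ℕ → Type*} [∀ n, NormedAddCommGroup (G n)] [∀ n, InnerProductSpace ℂ (G n)]

theorem single_mem_graph_directSum {T : ∀ n, G n →ₗ.[ℂ] G n} {n : ℕ} {x u : G n}
    (h : (x, u) ∈ (T n).graph) :
    ((lp.single 2 n x : lp G 2), (lp.single 2 n u : lp G 2)) ∈ (directSum T).graph := by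
  refine mem_graph_directSum.2 fun k => ?_
  by_cases hk : k = n
  · subst hk
    simpa using h
  · simp [hk]

variable [∀ n, CompleteSpace (G n)]

/-- Uniform convergence on compact time intervals follows from convergence on a dense set of initial
states: the set of good initial states is closed. -/
theorem IsUnitaryGroupOf.tendstoUniformlyOn_of_mem_closure {E : Type*} [NormedAddCommGroup E]
    [InnerProductSpace ℂ E] [CompleteSpace E] {H : ℝ → E →ₗ.[ℂ] E} {U : ℝ → ℝ → E →L[ℂ] E}
    (hU : ∀ σ : ℝ, 0 ≤ σ → IsUnitaryGroupOf (H σ) (U σ)) {K : Set ℝ} {ψ : E}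
    (h : ψ ∈ closure {φ | TendstoUniformlyOn (fun σ t => U σ t φ) (fun t => U 0 t φ) (𝓝[>] 0) K}) :
    TendstoUniformlyOn (fun σ t => U σ t ψ) (fun t => U 0 t ψ) (𝓝[>] 0) K := by
  rw [Metric.tendstoUniformlyOn_iff]
  intro ε hε
  obtain ⟨φ, hφ, hd⟩ := Metric.mem_closure_iff.1 h (ε / 3) (by positivity)
  filter_upwards [Metric.tendstoUniformlyOn_iff.1 hφ (ε / 3) (by positivity),
    self_mem_nhdsWithin] with σ hσ hpos t ht
  have h1 : ∀ s : ℝ, 0 ≤ s → dist (U s t ψ) (U s t φ) = dist ψ φ := fun s hs => by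
    rw [dist_eq_norm, ← map_sub, (hU s hs).norm_map, dist_eq_norm]
  have h2 := dist_triangle4 (U 0 t ψ) (U 0 t φ) (U σ t φ) (U σ t ψ)
  rw [h1 0 le_rfl, dist_comm (U σ t φ), h1 σ (le_of_lt hpos)] at h2
  linarith [hσ t ht]

/-- Strong convergence of bounded perturbations in every sector of a direct sum implies convergence
of the propagators, uniformly on compact time intervals. -/
theorem tendstoUniformlyOn_propagator {A : ∀ n, G n →ₗ.[ℂ] G n} {B : ℝ → ∀ n, G n →L[ℂ] G n}
    (hsa : ∀ σ n, IsSelfAdjoint ((B σ n : G n →ₗ[ℂ] G n) +ᵥ A n))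
    (hb : ∀ n, ∃ C : ℝ, ∀ σ : ℝ, 0 ≤ σ → ∀ x, ‖B σ n x‖ ≤ C * ‖x‖)
    (hB : ∀ n x, Tendsto (fun σ => B σ n x) (𝓝[>] 0) (𝓝 (B 0 n x)))
    {U : ℝ → ℝ → lp G 2 →L[ℂ] lp G 2}
    (hU : ∀ σ : ℝ, 0 ≤ σ →
      IsUnitaryGroupOf (directSum fun n => (B σ n : G n →ₗ[ℂ] G n) +ᵥ A n) (U σ))
    (ψ : lp G 2) {K : Set ℝ} (hK : IsCompact K) :
    TendstoUniformlyOn (fun σ t => U σ t ψ) (fun t => U 0 t ψ) (𝓝[>] 0) K := by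
  let S : Set (lp G 2) :=
    {φ | TendstoUniformlyOn (fun σ t => U σ t φ) (fun t => U 0 t φ) (𝓝[>] 0) K}
  have hclosed : ∀ φ, φ ∈ closure S → φ ∈ S := fun φ hφ =>
    IsUnitaryGroupOf.tendstoUniformlyOn_of_mem_closure hU hφ
  obtain ⟨R, hR⟩ := hK.isBounded.subset_closedBall (0 : ℝ)
  have hdom : ∀ n, ∀ x ∈ ((B 0 n : G n →ₗ[ℂ] G n) +ᵥ A n).domain, lp.single 2 n x ∈ S := by
    intro n x hx
    obtain ⟨u, hu⟩ := exists_isUnitaryGroupOf (hsa 0 n)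
    have hg := LinearPMap.mem_graph _ (⟨x, hx⟩ : ((B 0 n : G n →ₗ[ℂ] G n) +ᵥ A n).domain)
    set y := ((B 0 n : G n →ₗ[ℂ] G n) +ᵥ A n) ⟨x, hx⟩ with hy
    let ι : G n →L[ℂ] lp G 2 := lp.singleContinuousLinearMap ℂ G 2 n
    have hι : ∀ z, ‖ι z‖ = ‖z‖ := fun z => lp.norm_single (by norm_num) n z
    -- The embedded orbit of the sector's unperturbed group solves the equation of the full operator
    -- at `σ` with inhomogeneity `i(B σ - B 0)u(s)x`. Comparing inside the direct sum avoids
    -- describing how `U σ` restricts to sectors.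
    have hest : ∀ σ : ℝ, 0 ≤ σ → ∀ t, ‖ι (u t x) - U σ t (ι x)‖ ≤
        |∫ s in (0 : ℝ)..t, ‖B σ n (u s x) - B 0 n (u s x)‖| := by
      intro σ hσ t
      have := (hU σ hσ).norm_sub_le (isSelfAdjoint_directSum (hsa σ))
        (v := fun t => ι (u t x)) (w := fun t => Complex.I • ι (B σ n (u t x) - B 0 n (u t x)))
        (φ := fun t => ι (u t y + (B σ n (u t x) - B 0 n (u t x)))) ?_ ?_ ?_ t
      · simpa only [hu.map_zero, one_apply_eq_self, norm_smul, Complex.norm_I, one_mul, hι]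
          using this
      · intro t
        refine single_mem_graph_directSum ?_
        have h := mem_graph_add_bounded.1 (hu.map_graph hg t)
        rw [mem_graph_add_bounded]
        convert h using 2
        abel
      · exact ((ι.continuous.comp (((B σ n).continuous.comp (hu.continuous x)).sub
          ((B 0 n).continuous.comp (hu.continuous x)))).const_smul Complex.I)
      · intro t
        have h := (ι.restrictScalars ℝ).hasFDerivAt.comp_hasDerivAt t (hu.hasDerivAt hg t)
        refine h.congr_deriv ?_
        change ι (u t (-Complex.I • y)) = _
        rw [map_smul, map_smul, map_add, smul_add]
        module
    -- The case `σ = 0` of the estimate identifies the reference orbit.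
    have hzero : ∀ t, U 0 t (ι x) = ι (u t x) := by
      intro t
      have := hest 0 le_rfl t
      simp only [sub_self, norm_zero, intervalIntegral.integral_zero, abs_zero,
        norm_le_zero_iff] at this
      exact (sub_eq_zero.1 this).symm
    obtain ⟨C, hC⟩ := hb n
    have hcont : ∀ σ, Continuous fun s => ‖B σ n (u s x) - B 0 n (u s x)‖ := fun σ =>
      (((B σ n).continuous.comp (hu.continuous x)).sub
          ((B 0 n).continuous.comp (hu.continuous x))).norm
    have hlim : Tendsto (fun σ => ∫ s in (-R)..R, ‖B σ n (u s x) - B 0 n (u s x)‖) (𝓝[>] 0)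
        (𝓝 0) := by
      have h := intervalIntegral.tendsto_integral_filter_of_dominated_convergence
        (μ := volume) (a := -R) (b := R) (l := 𝓝[>] (0 : ℝ))
        (F := fun σ s => ‖B σ n (u s x) - B 0 n (u s x)‖) (f := fun _ => (0 : ℝ))
        (fun _ => C * ‖x‖ + C * ‖x‖) (Eventually.of_forall fun σ => (hcont σ).aestronglyMeasurable)
        ?_ intervalIntegrable_const (Eventually.of_forall fun s _ => ?_)
      · simpa using h
      · filter_upwards [self_mem_nhdsWithin] with σ hσ
        refine Eventually.of_forall fun s _ => ?_
        rw [norm_norm]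
        refine (norm_sub_le _ _).trans (add_le_add ?_ ?_)
        · exact (hC σ (le_of_lt hσ) _).trans_eq (by rw [hu.norm_map])
        · exact (hC 0 le_rfl _).trans_eq (by rw [hu.norm_map])
      · simpa using ((hB n (u s x)).sub_const (B 0 n (u s x))).norm
    change TendstoUniformlyOn _ _ _ _
    rw [Metric.tendstoUniformlyOn_iff]
    intro ε hε
    filter_upwards [hlim.eventually (gt_mem_nhds hε), self_mem_nhdsWithin] with σ hσ hpos t ht
    have ht' : |t| ≤ R := by simpa using hR ht
    have ht2 := abs_le.1 ht'
    change dist (U 0 t (ι x)) (U σ t (ι x)) < ε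
    rw [hzero, dist_eq_norm]
    refine (hest σ (le_of_lt hpos) t).trans_lt (lt_of_le_of_lt ?_ hσ)
    -- Enlarging the interval to `[-R, R]` makes the bound independent of `t ∈ K`.
    refine (intervalIntegral.abs_integral_mono_interval (c := -R) (d := R) ?_
      (Eventually.of_forall fun s => norm_nonneg _)
      ((hcont σ).intervalIntegrable _ _)).trans_eq ?_
    · have hR0 : 0 ≤ R := (abs_nonneg t).trans ht'
      rw [Set.uIoc_of_le (by linarith : -R ≤ R), Set.uIoc]
      exact Set.Ioc_subset_Ioc (le_min (by linarith) ht2.1) (max_le hR0 ht2.2)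
    · have hR0 : 0 ≤ R := (abs_nonneg t).trans ht'
      exact abs_of_nonneg (intervalIntegral.integral_nonneg (by linarith) fun s _ => norm_nonneg _)
  have hsingle : ∀ n x, lp.single 2 n x ∈ S := by
    intro n x
    refine hclosed _ ?_
    have hx := (hsa 0 n).dense_domain x
    exact map_mem_closure (lp.singleContinuousLinearMap ℂ G 2 n).continuous hx
      fun z hz => hdom n z hz
  refine hclosed ψ (mem_closure_of_tendsto (lp.hasSum_single (by norm_num) ψ)
    (Eventually.of_forall fun s => ?_))
  induction s using Finset.induction_on with
  | empty =>
    simp only [Finset.sum_empty, S, Set.mem_ofPred_eq, map_zero]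
    exact (tendsto_const_nhds).tendstoUniformlyOn_const K
  | insert n s hn ih =>
    rw [Finset.sum_insert hn]
    have := TendstoUniformlyOn.add (hsingle n (ψ n)) ih
    simp only [S, Set.mem_ofPred_eq, map_add]
    exact this

end Convergence

end SmearedFermi

theorem corollaryA2 (d : ℕ) (hd : 1 ≤ d)
    (V W : SmearedFermi.Rd d → ℝ) (hV : MemLp V ⊤ volume) (hW : MemLp W ⊤ volume)
    (Λ : Set (SmearedFermi.Rd d)) (hΛ : NullMeasurableSet Λ volume) :
    (∀ σ : ℝ, 0 ≤ σ →
      IsSelfAdjoint (SmearedFermi.hamiltonian Λ V W σ) ∧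
      ∃! U : ℝ → SmearedFermi.Fock d →L[ℂ] SmearedFermi.Fock d,
        SmearedFermi.IsUnitaryGroupOf (SmearedFermi.hamiltonian Λ V W σ) U) ∧
    ∀ U : ℝ → ℝ → SmearedFermi.Fock d →L[ℂ] SmearedFermi.Fock d,
      (∀ σ : ℝ, 0 ≤ σ →
        SmearedFermi.IsUnitaryGroupOf (SmearedFermi.hamiltonian Λ V W σ) (U σ)) →
      ∀ (ψ : SmearedFermi.Fock d) (K : Set ℝ), IsCompact K →
        TendstoUniformlyOn (fun σ t => U σ t ψ) (fun t => U 0 t ψ) (𝓝[>] 0) K := by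
  constructor
  · intro σ _
    have hsa := SmearedFermi.isSelfAdjoint_hamiltonian Λ V W σ
    obtain ⟨U, hU⟩ := SmearedFermi.exists_isUnitaryGroupOf hsa
    exact ⟨hsa, U, hU, fun U' hU' => SmearedFermi.IsUnitaryGroupOf.unique hsa hU' hU⟩
  · intro U hU ψ K hK
    let M : ∀ n, SmearedFermi.antisym d n →L[ℂ] SmearedFermi.antisym d n := fun n =>
      SmearedFermi.mulAntisym fun x : SmearedFermi.Conf d n => ∑ k, V (x k)
    -- The potential `V` joins the bounded part as a summand independent of `σ`, so only the
    -- interaction has to converge.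
    refine SmearedFermi.tendstoUniformlyOn_propagator (A := SmearedFermi.kinetic d)
      (B := fun σ n => M n + SmearedFermi.interaction Λ W σ n)
      (fun σ n => SmearedFermi.isSelfAdjoint_hamiltonianN Λ V W σ n) (fun n => ?_)
      (fun n x => ?_) hU ψ hK
    · obtain ⟨C, hC⟩ := (SmearedFermi.tendsto_interaction hW hΛ n).1
      refine ⟨‖M n‖ + C, fun σ hσ x => ?_⟩
      rw [add_apply, add_mul]
      exact (norm_add_le _ _).trans (add_le_add ((M n).le_opNorm x) (hC σ hσ x))
    · exact ((SmearedFermi.tendsto_interaction hW hΛ n).2 x).const_add (M n x)
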